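/- Let $k_1,k_3>0$ and $D=\{(r,\theta):0<r<1,\ 0<\theta<\pi\}$. Let $X_1(D)$ be the set of all $\psi\in H^1_{\rm loc}(D)$ with \[ \int_D\Big[(\partial_r\psi)^2+\frac1{r^2}(\partial_\theta\psi)^2+\frac1{r^2\sin^2\theta}(\psi-\theta)^2\Big]\,r^2\sin\theta\,d\theta\,dr<\infty . \] Such a $\psi$ has a trace $\psi|_{r=1}$ on $\{r=1\}$. For $\psi\in X_1(D)$ let \begin{align*} J[\psi]={}&\pi\int_0^1\!\!\int_0^\pi\Big\{\big(k_1\sin^2(\psi-\theta)+k_3\cos^2(\psi-\theta)\big)(\partial_r\psi)^2 +\frac1{r^2}\big(k_1\cos^2(\psi-\theta)+k_3\sin^2(\psi-\theta)\big)(\partial_\theta\psi)^2\\ &\quad-\frac{2(k_1-k_3)}{r}\sin(\psi-\theta)\cos(\psi-\theta)\,\partial_r\psi\,\partial_\theta\psi +\frac{k_1}{r^2}\frac{\sin^2\psi}{\sin^2\theta}\Big\}\,r^2\sin\theta\,d\theta\,dr\\ &+k_1\pi\int_0^\pi\Big[(\psi-\sin\psi\cos\psi)\cos\theta-\sin^2\psi\,\sin\theta\Big]_{r=1}\,d\theta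 . \end{align*} Let $t\in(0,\pi)$. The initial value problem \[ \psi_t'=\frac{k_1^{1/2}\sin\psi_t}{\sin\theta\,\big(k_1\cos^2(\psi_t-\theta)+k_3\sin^2(\psi_t-\theta)\big)^{1/2}}\ \text{ in }(0,\pi),\qquad \psi_t(\pi/2)=t, \] has a unique solution $\psi_t$ on $(0,\pi)$. Regarded as a function of $(r,\theta)$ that does not depend on $r$, it belongs to $X_1(D)$ and has trace $\psi_t$ on $\{r=1\}$, and \[ J[\psi_t]\le J[\psi]\quad\text{for all }\psi\in X_1(D)\text{ with }\psi|_{r=1}=\psi_t , \] where equality holds if and only if $\psi=\psi_t$ almost everywhere in $D$. -/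

import Mathlib

open MeasureTheory Set
open scoped ContDiff

noncomputable section

namespace OseenFrank

/-- The half disc in polar coordinates: `D = {(r, θ) : 0 < r < 1, 0 < θ < π}`. -/
def D : Set (ℝ × ℝ) := Ioo 0 1 ×ˢ Ioo 0 Real.pi

/-- The coordinate direction of `r`. -/
def eR : ℝ × ℝ := (1, 0)

/-- The coordinate direction of `θ`. -/
def eTheta : ℝ × ℝ := (0, 1)

/-- `g` is the weak (distributional) derivative of `ψ` in `D` in the direction `v`. -/
def IsWeakDeriv (v : ℝ × ℝ) (ψ g : ℝ × ℝ → ℝ) : Prop :=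
  LocallyIntegrableOn ψ D ∧ LocallyIntegrableOn g D ∧
    ∀ φ : ℝ × ℝ → ℝ, ContDiff ℝ ∞ φ → HasCompactSupport φ → tsupport φ ⊆ D →
      ∫ x in D, ψ x * fderiv ℝ φ x v = - ∫ x in D, g x * φ x

open Classical in
/-- The weak derivative of `ψ` in `D` in the direction `v` (unique up to null sets;
`0` if there is none). -/
def weakDeriv (v : ℝ × ℝ) (ψ : ℝ × ℝ → ℝ) : ℝ × ℝ → ℝ :=
  if h : ∃ g, IsWeakDeriv v ψ g then h.choose else 0

/-- `f ∈ L²_loc(D)`: square integrable on every compact subset of `D`. -/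
def MemL2loc (f : ℝ × ℝ → ℝ) : Prop :=
  ∀ K : Set (ℝ × ℝ), IsCompact K → K ⊆ D → MemLp f 2 (volume.restrict K)

/-- `ψ ∈ H¹_loc(D)`. -/
def MemH1loc (ψ : ℝ × ℝ → ℝ) : Prop :=
  MemL2loc ψ ∧
    (∃ g, IsWeakDeriv eR ψ g ∧ MemL2loc g) ∧
    (∃ g, IsWeakDeriv eTheta ψ g ∧ MemL2loc g)

/-- The weighted Sobolev class `X_j(D)`: all `ψ ∈ H¹_loc(D)` with
`∫_D [(∂_r ψ)² + r⁻² (∂_θ ψ)² + (r sin θ)⁻² (ψ - jθ)²] r² sin θ dθ dr < ∞`. -/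
def MemX (j : ℤ) (ψ : ℝ × ℝ → ℝ) : Prop :=
  MemH1loc ψ ∧
    IntegrableOn (fun x : ℝ × ℝ =>
      ((weakDeriv eR ψ x) ^ 2 + 1 / x.1 ^ 2 * (weakDeriv eTheta ψ x) ^ 2
        + 1 / (x.1 ^ 2 * Real.sin x.2 ^ 2) * (ψ x - j * x.2) ^ 2)
        * (x.1 ^ 2 * Real.sin x.2)) D

/-- `f : (0, π) → ℝ` is the trace of `ψ` on `{r = 1}`: `ψ` and `∂_r ψ` are locally integrable up to
`{r = 1}`, and integration by parts in `r` against smooth functions compactly supported in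
`(0, ∞) × (0, π)` produces the boundary values `f`. -/
def HasTrace (ψ : ℝ × ℝ → ℝ) (f : ℝ → ℝ) : Prop :=
  LocallyIntegrableOn f (Ioo 0 Real.pi) ∧
    LocallyIntegrableOn ψ (Ioc 0 1 ×ˢ Ioo 0 Real.pi) ∧
    LocallyIntegrableOn (weakDeriv eR ψ) (Ioc 0 1 ×ˢ Ioo 0 Real.pi) ∧
    ∀ φ : ℝ × ℝ → ℝ, ContDiff ℝ ∞ φ → HasCompactSupport φ →
      tsupport φ ⊆ Ioi 0 ×ˢ Ioo 0 Real.pi →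
      ∫ x in D, (ψ x * fderiv ℝ φ x eR + weakDeriv eR ψ x * φ x)
        = ∫ θ in Ioo 0 Real.pi, f θ * φ (1, θ)

open Classical in
/-- The trace of `ψ` on `{r = 1}` (unique up to null sets; `0` if there is none). -/
def trace (ψ : ℝ × ℝ → ℝ) : ℝ → ℝ :=
  if h : ∃ f, HasTrace ψ f then h.choose else 0

/-- The integrand (without the weight `r² sin θ`) of the bulk part of the reduced energy, at
`(r, θ)`, for the value `s` of `ψ` and the values `p`, `q` of `∂_r ψ`, `∂_θ ψ`. -/
def density (k₁ k₃ r θ s p q : ℝ) : ℝ :=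
  (k₁ * Real.sin (s - θ) ^ 2 + k₃ * Real.cos (s - θ) ^ 2) * p ^ 2
    + 1 / r ^ 2 * (k₁ * Real.cos (s - θ) ^ 2 + k₃ * Real.sin (s - θ) ^ 2) * q ^ 2
    - 2 * (k₁ - k₃) / r * Real.sin (s - θ) * Real.cos (s - θ) * p * q
    + k₁ / r ^ 2 * (1 / Real.sin θ ^ 2) * Real.sin s ^ 2

/-- The reduced energy `J[ψ]`. -/
def J (k₁ k₃ : ℝ) (ψ : ℝ × ℝ → ℝ) : ℝ :=
  Real.pi * (∫ x in D,
      density k₁ k₃ x.1 x.2 (ψ x) (weakDeriv eR ψ x) (weakDeriv eTheta ψ x)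
        * (x.1 ^ 2 * Real.sin x.2))
    + k₁ * Real.pi * ∫ θ in (0 : ℝ)..Real.pi,
        ((trace ψ θ - Real.sin (trace ψ θ) * Real.cos (trace ψ θ)) * Real.cos θ
          - Real.sin (trace ψ θ) ^ 2 * Real.sin θ)

/-- `f` solves on `(0, π)` the initial value problem
`f' = k₁^{1/2} sin f / (sin θ (k₁ cos²(f - θ) + k₃ sin²(f - θ))^{1/2})`, `f(π/2) = t`. -/
def IsPsi (k₁ k₃ t : ℝ) (f : ℝ → ℝ) : Prop :=
  (∀ θ ∈ Ioo 0 Real.pi, HasDerivAt f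
    (√k₁ * Real.sin (f θ) /
      (Real.sin θ * √(k₁ * Real.cos (f θ - θ) ^ 2 + k₃ * Real.sin (f θ - θ) ^ 2))) θ) ∧
  f (Real.pi / 2) = t

/-- A function of `θ` regarded as a function of `(r, θ)`. -/
def lift (f : ℝ → ℝ) : ℝ × ℝ → ℝ := fun x => f x.2

end OseenFrank

end

namespace OseenFrank

open Filter Topology

/-! The proof is a calibration. Put `w = ψ - θ`, `m(w) = √(k₁ cos² w + k₃ sin² w)` and let `slope`
be the right-hand side of the differential equation. Completing the square in `∂_θ ψ`
(`density_mul_eq`) gives the pointwise identity density · r² sin θ = 2√k₁ [r sin ψ m'(w) ∂_r ψ + sin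
ψ m(w) ∂_θ ψ] + sin θ · Q_w(r ∂_r ψ, ∂_θ ψ - slope), where `Q_w` is the positive definite form
`quadForm`.

The bracket is a null Lagrangian. There are potentials `R(w, θ)` (`radialPotential`) and `P(w, θ)`
(`angularPotential`), both zero at `w = 0`, such that along any `ψ` ∂_r (r R) = r sin ψ m'(w) ∂_r ψ
+ R, ∂_θ P = sin ψ m(w) ∂_θ ψ - R - √k₁ sin θ. Hence the bracket equals `∂_r (r R) + ∂_θ P + √k₁ sin
θ`. Finite energy makes `R` and `P / sin θ` integrable, so nothing is left at `r = 0` or on the axis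
`θ = 0, π`, and the integral of the bracket depends only on the trace (`integral_radialTerm`,
`integral_angularTerm`). The boundary term of `J` also depends only on the trace. Thus, for equal
traces, energies differ by `π` times the difference of the integrals of the last term, the `excess`
(`J_sub_J`).

The excess is nonnegative and vanishes for `ψ_t`, which has `∂_r ψ_t = 0` and solves the
differential equation. Conversely, zero excess forces `∂_r ψ = 0`, so `ψ` equals its trace on almost
every ray.

Since `ψ` is only a Sobolev function, integration takes place on lines: weak derivatives give
absolutely continuous representatives on almost every ray and half circle
(`ae_exists_eq_const_add_integral`, `HasTrace.ae_eq_add_integral`). That `ψ_t` has finite energy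
follows from the differential equation, because `ψ_t' sin ψ_t = -(cos ψ_t)'` has integral at most 2.
-/

/-- The square root of the coefficient of `(∂_θ ψ)²` in the reduced energy, as a function of
`ψ - θ`. -/
noncomputable def modulus (k₁ k₃ x : ℝ) : ℝ :=
  √(k₁ * Real.cos x ^ 2 + k₃ * Real.sin x ^ 2)

/-! ### Bounds and derivative of the modulus -/

section modulus

variable {k₁ k₃ : ℝ}

lemma min_le_combination (x : ℝ) :
    min k₁ k₃ ≤ k₁ * Real.cos x ^ 2 + k₃ * Real.sin x ^ 2 := by
  have h1 := mul_le_mul_of_nonneg_right (min_le_left k₁ k₃) (sq_nonneg (Real.cos x))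
  have h2 := mul_le_mul_of_nonneg_right (min_le_right k₁ k₃) (sq_nonneg (Real.sin x))
  linear_combination h1 + h2 - min k₁ k₃ * Real.sin_sq_add_cos_sq x

lemma combination_le_max (x : ℝ) :
    k₁ * Real.cos x ^ 2 + k₃ * Real.sin x ^ 2 ≤ max k₁ k₃ := by
  have h1 := mul_le_mul_of_nonneg_right (le_max_left k₁ k₃) (sq_nonneg (Real.cos x))
  have h2 := mul_le_mul_of_nonneg_right (le_max_right k₁ k₃) (sq_nonneg (Real.sin x))
  linear_combination h1 + h2 + max k₁ k₃ * Real.sin_sq_add_cos_sq x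

lemma sqrt_min_le_modulus (x : ℝ) : √(min k₁ k₃) ≤ modulus k₁ k₃ x :=
  Real.sqrt_le_sqrt (min_le_combination x)

lemma modulus_le (x : ℝ) : modulus k₁ k₃ x ≤ √(max k₁ k₃) :=
  Real.sqrt_le_sqrt (combination_le_max x)

variable (hk₁ : 0 < k₁) (hk₃ : 0 < k₃)

include hk₁ hk₃

lemma combination_pos (x : ℝ) : 0 < k₁ * Real.cos x ^ 2 + k₃ * Real.sin x ^ 2 :=
  (lt_min hk₁ hk₃).trans_le (min_le_combination x)

lemma modulus_pos (x : ℝ) : 0 < modulus k₁ k₃ x :=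
  Real.sqrt_pos.2 (combination_pos hk₁ hk₃ x)

lemma modulus_sq (x : ℝ) :
    modulus k₁ k₃ x ^ 2 = k₁ * Real.cos x ^ 2 + k₃ * Real.sin x ^ 2 :=
  Real.sq_sqrt (combination_pos hk₁ hk₃ x).le

lemma hasDerivAt_modulus (x : ℝ) :
    HasDerivAt (modulus k₁ k₃)
      ((k₃ - k₁) * Real.sin x * Real.cos x / modulus k₁ k₃ x) x := by
  have h := ((((Real.hasDerivAt_cos x).pow 2).const_mul k₁).add
    (((Real.hasDerivAt_sin x).pow 2).const_mul k₃)).sqrt (combination_pos hk₁ hk₃ x).ne'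
  have hm : √(k₁ * Real.cos x ^ 2 + k₃ * Real.sin x ^ 2) ≠ 0 := (modulus_pos hk₁ hk₃ x).ne'
  refine h.congr_deriv ?_
  simp only [modulus, Pi.add_apply, Pi.pow_apply]
  field_simp
  ring

omit hk₁ hk₃ in
lemma continuous_modulus : Continuous (modulus k₁ k₃) := by
  unfold modulus; fun_prop

end modulus

/-! ### The initial value problem -/

/-- The right-hand side of the differential equation for the minimizers. -/
noncomputable def slope (k₁ k₃ θ s : ℝ) : ℝ :=
  √k₁ * Real.sin s / (Real.sin θ * modulus k₁ k₃ (s - θ))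

section ode

variable {k₁ k₃ : ℝ} (hk₁ : 0 < k₁) (hk₃ : 0 < k₃)

include hk₁ hk₃

lemma hasDerivAt_slope (θ s : ℝ) (hθ : Real.sin θ ≠ 0) :
    HasDerivAt (slope k₁ k₃ θ)
      (√k₁ / Real.sin θ * (Real.cos s / modulus k₁ k₃ (s - θ)
        - Real.sin s * ((k₃ - k₁) * Real.sin (s - θ) * Real.cos (s - θ))
          / modulus k₁ k₃ (s - θ) ^ 3)) s := by
  have hm := (modulus_pos hk₁ hk₃ (s - θ)).ne'
  have h1 : HasDerivAt (fun s => modulus k₁ k₃ (s - θ))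
      ((k₃ - k₁) * Real.sin (s - θ) * Real.cos (s - θ) / modulus k₁ k₃ (s - θ)) s :=
    (hasDerivAt_modulus hk₁ hk₃ (s - θ)).comp_sub_const s θ
  have h := ((Real.hasDerivAt_sin s).const_mul √k₁).div (h1.const_mul (Real.sin θ))
    (mul_ne_zero hθ hm)
  refine h.congr_deriv ?_
  field_simp

/-- The only singularity is at `sin θ = 0`; away from it `sin θ ≥ sin ε` and `modulus ≥ √(min k₁
k₃)`, so the estimates are uniform in `θ` and global in `s`. -/
lemma slope_bounds {ε : ℝ} (hε : 0 < ε) (hε' : ε < Real.pi / 2) :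
    ∃ K L : NNReal, ∀ θ ∈ Icc ε (Real.pi - ε),
      LipschitzWith K (slope k₁ k₃ θ) ∧ ∀ s, |slope k₁ k₃ θ s| ≤ L := by
  have hpi := Real.pi_pos
  set c := √(min k₁ k₃) with hc
  have hc0 : 0 < c := Real.sqrt_pos.2 (lt_min hk₁ hk₃)
  have hσ : 0 < Real.sin ε := Real.sin_pos_of_pos_of_lt_pi hε (by linarith)
  have hsin : ∀ θ ∈ Icc ε (Real.pi - ε), Real.sin ε ≤ Real.sin θ := by
    intro θ hθ
    rcases le_total θ (Real.pi / 2) with h | h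
    · exact Real.sin_le_sin_of_le_of_le_pi_div_two (by linarith) h hθ.1
    · rw [← Real.sin_pi_sub θ]
      exact Real.sin_le_sin_of_le_of_le_pi_div_two (by linarith) (by linarith) (by linarith [hθ.2])
  have hK : 0 ≤ √k₁ / Real.sin ε * (1 / c + |k₃ - k₁| / c ^ 3) := by positivity
  have hL : 0 ≤ √k₁ / (Real.sin ε * c) := by positivity
  refine ⟨NNReal.mk _ hK, NNReal.mk _ hL, fun θ hθ => ⟨?_, fun s => ?_⟩⟩
  · have hθ0 : 0 < Real.sin θ := hσ.trans_le (hsin θ hθ)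
    refine lipschitzWith_of_nnnorm_deriv_le
      (fun s => (hasDerivAt_slope hk₁ hk₃ θ s hθ0.ne').differentiableAt) fun s => ?_
    rw [(hasDerivAt_slope hk₁ hk₃ θ s hθ0.ne').deriv, ← NNReal.coe_le_coe, coe_nnnorm,
      NNReal.coe_mk, Real.norm_eq_abs, abs_mul, abs_div, abs_of_pos hθ0,
      abs_of_nonneg (Real.sqrt_nonneg k₁)]
    have hm := modulus_pos hk₁ hk₃ (s - θ)
    have hcm : c ≤ modulus k₁ k₃ (s - θ) := sqrt_min_le_modulus _
    have h1 : |Real.cos s / modulus k₁ k₃ (s - θ)| ≤ 1 / c := by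
      rw [abs_div, abs_of_pos hm]
      gcongr
      exact Real.abs_cos_le_one s
    have h2 : |Real.sin s * ((k₃ - k₁) * Real.sin (s - θ) * Real.cos (s - θ))
          / modulus k₁ k₃ (s - θ) ^ 3| ≤ |k₃ - k₁| / c ^ 3 := by
      rw [abs_div, abs_of_pos (pow_pos hm 3)]
      refine div_le_div₀ (abs_nonneg _) ?_ (pow_pos hc0 3) (pow_le_pow_left₀ hc0.le hcm 3)
      rw [abs_mul, abs_mul, abs_mul]
      calc _ ≤ 1 * (|k₃ - k₁| * 1 * 1) := by
            gcongr
            · exact Real.abs_sin_le_one s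
            · exact Real.abs_sin_le_one _
            · exact Real.abs_cos_le_one _
        _ = _ := by ring
    gcongr
    · exact hsin θ hθ
    · exact (abs_sub _ _).trans (add_le_add h1 h2)
  · have hθ0 : 0 < Real.sin θ := hσ.trans_le (hsin θ hθ)
    have hm := modulus_pos hk₁ hk₃ (s - θ)
    have hcm : c ≤ modulus k₁ k₃ (s - θ) := sqrt_min_le_modulus _
    rw [slope, NNReal.coe_mk, abs_div, abs_mul, abs_mul, abs_of_pos hθ0, abs_of_pos hm,
      abs_of_nonneg (Real.sqrt_nonneg k₁)]
    gcongr
    · exact mul_le_of_le_one_right (Real.sqrt_nonneg _) (Real.abs_sin_le_one s)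
    · exact hsin θ hθ

omit hk₁ hk₃ in
lemma exists_margin {θ₀ θ₁ : ℝ} (h₀ : θ₀ ∈ Ioo 0 Real.pi) (h₁ : θ₁ ∈ Ioo 0 Real.pi) :
    ∃ ε, 0 < ε ∧ ε < Real.pi / 2 ∧ θ₀ ∈ Ioo ε (Real.pi - ε) ∧ θ₁ ∈ Ioo ε (Real.pi - ε) := by
  have hpi := Real.pi_pos
  obtain ⟨ε, hε, h⟩ : ∃ ε, 0 < ε ∧
      ε < min (min θ₀ (Real.pi - θ₀)) (min (min θ₁ (Real.pi - θ₁)) (Real.pi / 2)) := by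
    refine exists_between ?_
    simp only [lt_min_iff]
    exact ⟨⟨h₀.1, by linarith [h₀.2]⟩, ⟨h₁.1, by linarith [h₁.2]⟩, by positivity⟩
  simp only [lt_min_iff] at h
  exact ⟨ε, hε, h.2.2, ⟨h.1.1, by linarith [h.1.2]⟩, ⟨h.2.1.1, by linarith [h.2.1.2]⟩⟩

/-- The Lipschitz constant degenerates at the ends of `(0, π)`, so the comparison is made on a
smaller interval containing both the base point and the point in question. -/
lemma eqOn_of_hasDerivAt_slope {f g : ℝ → ℝ} {θ₀ : ℝ} (h₀ : θ₀ ∈ Ioo 0 Real.pi)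
    (hf : ∀ θ ∈ Ioo 0 Real.pi, HasDerivAt f (slope k₁ k₃ θ (f θ)) θ)
    (hg : ∀ θ ∈ Ioo 0 Real.pi, HasDerivAt g (slope k₁ k₃ θ (g θ)) θ) (h : f θ₀ = g θ₀) :
    EqOn f g (Ioo 0 Real.pi) := by
  intro θ₁ h₁
  obtain ⟨ε, hε, hε', m₀, m₁⟩ := exists_margin h₀ h₁
  obtain ⟨K, L, hKL⟩ := slope_bounds hk₁ hk₃ hε hε'
  have hss : Ioo ε (Real.pi - ε) ⊆ Ioo 0 Real.pi := Ioo_subset_Ioo hε.le (by linarith)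
  exact ODE_solution_unique_of_mem_Ioo (v := slope k₁ k₃) (s := fun _ => univ) (K := K)
    (fun θ hθ => (hKL θ (Ioo_subset_Icc_self hθ)).1.lipschitzOnWith) m₀
    (fun θ hθ => ⟨hf θ (hss hθ), mem_univ _⟩) (fun θ hθ => ⟨hg θ (hss hθ), mem_univ _⟩) h m₁

lemma exists_solution_Icc (t : ℝ) {ε : ℝ} (hε : 0 < ε) (hε' : ε < Real.pi / 2) :
    ∃ f : ℝ → ℝ, f (Real.pi / 2) = t ∧
      ∀ θ ∈ Ioo ε (Real.pi - ε), HasDerivAt f (slope k₁ k₃ θ (f θ)) θ := by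
  obtain ⟨K, L, hKL⟩ := slope_bounds hk₁ hk₃ hε hε'
  have hpi := Real.pi_pos
  have hmid : Real.pi / 2 ∈ Icc ε (Real.pi - ε) := ⟨hε'.le, by linarith⟩
  -- The speed is at most `L` for all `s`, so a ball of radius `L π` cannot be left within the
  -- interval, and one application of Picard–Lindelöf covers all of it.
  have hP : IsPicardLindelof (slope k₁ k₃) (⟨Real.pi / 2, hmid⟩ : Icc ε (Real.pi - ε)) t
      (L * Real.toNNReal Real.pi) 0 L K := by
    refine ⟨fun θ hθ => (hKL θ hθ).1.lipschitzOnWith, fun s _ => ?_, fun θ hθ s _ => (hKL θ hθ).2 s,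
      ?_⟩
    · unfold slope
      refine ContinuousOn.div (by fun_prop) ?_ fun θ hθ => ?_
      · exact (Real.continuous_sin.mul (continuous_modulus.comp
          (by fun_prop : Continuous fun θ : ℝ => s - θ))).continuousOn
      · exact mul_ne_zero (Real.sin_pos_of_pos_of_lt_pi (hε.trans_le hθ.1)
          (by linarith [hθ.2])).ne' (modulus_pos hk₁ hk₃ _).ne'
    · simp only [NNReal.coe_mul, Real.coe_toNNReal _ hpi.le, NNReal.coe_zero, sub_zero]
      gcongr
      exact max_le (by linarith) (by linarith)
  obtain ⟨f, hf, hf'⟩ := hP.exists_eq_forall_mem_Icc_hasDerivWithinAt₀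
  exact ⟨f, hf, fun θ hθ =>
    (hf' θ (Ioo_subset_Icc_self hθ)).hasDerivAt (Icc_mem_nhds hθ.1 hθ.2)⟩

theorem exists_isPsi (t : ℝ) : ∃ f, IsPsi k₁ k₃ t f := by
  have hpi := Real.pi_pos
  have hmid : Real.pi / 2 ∈ Ioo 0 Real.pi := ⟨by linarith, by linarith⟩
  have hex : ∀ ε : Ioo 0 (Real.pi / 2), ∃ f : ℝ → ℝ, f (Real.pi / 2) = t ∧
      ∀ θ ∈ Ioo (ε : ℝ) (Real.pi - ε), HasDerivAt f (slope k₁ k₃ θ (f θ)) θ :=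
    fun ε => exists_solution_Icc hk₁ hk₃ t ε.2.1 ε.2.2
  choose f hf hf' using hex
  have hagree : ∀ ε δ : Ioo 0 (Real.pi / 2), ∀ θ ∈ Ioo (ε : ℝ) (Real.pi - ε),
      θ ∈ Ioo (δ : ℝ) (Real.pi - δ) → f ε θ = f δ θ := by
    intro ε δ θ h1 h2
    -- The larger margin gives the smaller of the two intervals, where both solutions are defined.
    set γ : Ioo 0 (Real.pi / 2) := max ε δ
    have hγ : θ ∈ Ioo (γ : ℝ) (Real.pi - γ) := by
      rcases max_choice ε δ with h | h <;> simpa only [γ, h]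
    obtain ⟨K, L, hKL⟩ := slope_bounds hk₁ hk₃ γ.2.1 γ.2.2
    have hεγ : (ε : ℝ) ≤ γ := le_max_left ε δ
    have hδγ : (δ : ℝ) ≤ γ := le_max_right ε δ
    exact ODE_solution_unique_of_mem_Ioo (v := slope k₁ k₃) (s := fun _ => univ) (K := K)
      (fun θ hθ => (hKL θ (Ioo_subset_Icc_self hθ)).1.lipschitzOnWith)
      (⟨γ.2.2, by linarith [γ.2.2]⟩ : Real.pi / 2 ∈ Ioo (γ : ℝ) (Real.pi - γ))
      (fun θ hθ => ⟨hf' ε θ ⟨by linarith [hθ.1], by linarith [hθ.2]⟩, mem_univ _⟩)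
      (fun θ hθ => ⟨hf' δ θ ⟨by linarith [hθ.1], by linarith [hθ.2]⟩, mem_univ _⟩)
      ((hf ε).trans (hf δ).symm) hγ
  have hm : ∀ θ : Ioo 0 Real.pi, ∃ ε : Ioo 0 (Real.pi / 2), (θ : ℝ) ∈ Ioo (ε : ℝ) (Real.pi - ε) := by
    intro θ
    obtain ⟨ε, h1, h2, h3, -⟩ := exists_margin θ.2 θ.2
    exact ⟨⟨ε, h1, h2⟩, h3⟩
  choose e he using hm
  classical
  -- The glued function evaluates at each point a solution defined there; the choice does not matter
  -- by `hagree`, nor does the value 0 outside `(0, π)`.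
  have hglue : ∀ ε : Ioo 0 (Real.pi / 2), ∀ θ ∈ Ioo (ε : ℝ) (Real.pi - ε),
      (if h : θ ∈ Ioo 0 Real.pi then f (e ⟨θ, h⟩) θ else 0) = f ε θ := by
    intro ε θ hθ
    have h : θ ∈ Ioo 0 Real.pi := ⟨ε.2.1.trans hθ.1, hθ.2.trans (by linarith [ε.2.1])⟩
    rw [dif_pos h]
    exact hagree _ _ θ (he ⟨θ, h⟩) hθ
  refine ⟨fun θ => if h : θ ∈ Ioo 0 Real.pi then f (e ⟨θ, h⟩) θ else 0, fun θ hθ => ?_, ?_⟩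
  · have hmem := he ⟨θ, hθ⟩
    have h1 := hf' _ θ hmem
    rw [← hglue _ θ hmem] at h1
    refine h1.congr_of_eventuallyEq ?_
    filter_upwards [Ioo_mem_nhds hmem.1 hmem.2] with x hx
    exact hglue _ x hx
  · exact (dif_pos hmid).trans (hf _)

end ode

/-! ### Range and monotonicity of the solutions -/

section psi

variable {k₁ k₃ t : ℝ} (hk₁ : 0 < k₁) (hk₃ : 0 < k₃) {f : ℝ → ℝ}

omit hk₁ hk₃ in
lemma IsPsi.hasDerivAt (hf : IsPsi k₁ k₃ t f) {θ : ℝ} (hθ : θ ∈ Ioo 0 Real.pi) :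
    HasDerivAt f (slope k₁ k₃ θ (f θ)) θ :=
  hf.1 θ hθ

omit hk₁ hk₃ in
lemma IsPsi.continuousOn (hf : IsPsi k₁ k₃ t f) : ContinuousOn f (Ioo 0 Real.pi) :=
  fun _ hθ => (hf.hasDerivAt hθ).continuousAt.continuousWithinAt

include hk₁ hk₃

lemma IsPsi.eqOn {g : ℝ → ℝ} (hf : IsPsi k₁ k₃ t f) (hg : IsPsi k₁ k₃ t g) :
    EqOn f g (Ioo 0 Real.pi) :=
  eqOn_of_hasDerivAt_slope hk₁ hk₃ ⟨by linarith [Real.pi_pos], by linarith [Real.pi_pos]⟩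
    (fun _ h => hf.hasDerivAt h) (fun _ h => hg.hasDerivAt h) (hf.2.trans hg.2.symm)

/-- A zero of the sine is a constant solution, which by uniqueness no other solution can meet. -/
lemma IsPsi.ne_of_sin_eq_zero (hf : IsPsi k₁ k₃ t f) {c : ℝ} (hc : Real.sin c = 0) (htc : t ≠ c)
    {θ : ℝ} (hθ : θ ∈ Ioo 0 Real.pi) : f θ ≠ c := by
  intro h
  have := eqOn_of_hasDerivAt_slope hk₁ hk₃ hθ (fun _ h => hf.hasDerivAt h) (g := fun _ => c)
    (fun θ _ => by simpa [slope, hc] using hasDerivAt_const θ c) h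
    (show Real.pi / 2 ∈ Ioo 0 Real.pi from ⟨by linarith [Real.pi_pos], by linarith [Real.pi_pos]⟩)
  exact htc (hf.2.symm.trans this)

/-- To leave `(0, π)` the solution would have to take the value 0 or `π` by the intermediate value
theorem, and these are constant solutions. -/
lemma IsPsi.mem_Ioo (hf : IsPsi k₁ k₃ t f) (ht : t ∈ Ioo 0 Real.pi) {θ : ℝ}
    (hθ : θ ∈ Ioo 0 Real.pi) : f θ ∈ Ioo 0 Real.pi := by
  have hpi := Real.pi_pos
  have hmid : Real.pi / 2 ∈ Ioo 0 Real.pi := ⟨by linarith, by linarith⟩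
  have hconn := (isPreconnected_Ioo (a := (0 : ℝ)) (b := Real.pi)).image f hf.continuousOn
  have hord := hconn.ordConnected
  have ht' : t ∈ f '' Ioo 0 Real.pi := ⟨_, hmid, hf.2⟩
  have hθ' : f θ ∈ f '' Ioo 0 Real.pi := mem_image_of_mem f hθ
  constructor
  · by_contra h
    obtain ⟨x, hx, hx'⟩ := hord.out hθ' ht' ⟨not_lt.1 h, ht.1.le⟩
    exact hf.ne_of_sin_eq_zero hk₁ hk₃ Real.sin_zero ht.1.ne' hx hx'
  · by_contra h
    obtain ⟨x, hx, hx'⟩ := hord.out ht' hθ' ⟨ht.2.le, not_lt.1 h⟩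
    exact hf.ne_of_sin_eq_zero hk₁ hk₃ Real.sin_pi ht.2.ne hx hx'

lemma IsPsi.slope_nonneg (hf : IsPsi k₁ k₃ t f) (ht : t ∈ Ioo 0 Real.pi) {θ : ℝ}
    (hθ : θ ∈ Ioo 0 Real.pi) : 0 ≤ slope k₁ k₃ θ (f θ) := by
  have h1 := hf.mem_Ioo hk₁ hk₃ ht hθ
  have h2 := Real.sin_pos_of_mem_Ioo h1
  have h3 := Real.sin_pos_of_mem_Ioo hθ
  have h4 := modulus_pos hk₁ hk₃ (f θ - θ)
  unfold slope
  positivity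

lemma IsPsi.monotoneOn (hf : IsPsi k₁ k₃ t f) (ht : t ∈ Ioo 0 Real.pi) :
    MonotoneOn f (Ioo 0 Real.pi) := by
  refine monotoneOn_of_hasDerivWithinAt_nonneg (f' := fun θ => slope k₁ k₃ θ (f θ))
    (convex_Ioo _ _) hf.continuousOn ?_ ?_
  · intro θ hθ
    exact (hf.hasDerivAt (interior_subset hθ)).hasDerivWithinAt
  · intro θ hθ
    exact hf.slope_nonneg hk₁ hk₃ ht (interior_subset hθ)

lemma IsPsi.continuousOn_slope (hf : IsPsi k₁ k₃ t f) :
    ContinuousOn (fun θ => slope k₁ k₃ θ (f θ)) (Ioo 0 Real.pi) := by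
  have := hf.continuousOn
  unfold slope
  refine ContinuousOn.div (by fun_prop) ?_ fun θ hθ => ?_
  · exact Real.continuous_sin.continuousOn.mul (continuous_modulus.comp_continuousOn
      (this.sub continuousOn_id))
  · exact mul_ne_zero (Real.sin_pos_of_mem_Ioo hθ).ne' (modulus_pos hk₁ hk₃ _).ne'

end psi

/-! ### Calculus along absolutely continuous curves -/

lemma _root_.AbsolutelyContinuousOnInterval.of_dist_le {h u : ℝ → ℝ} {a b K : ℝ}
    (hu : AbsolutelyContinuousOnInterval u a b)
    (hK : ∀ x ∈ uIcc a b, ∀ y ∈ uIcc a b, dist (h x) (h y) ≤ K * (dist (u x) (u y) + dist x y)) :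
    AbsolutelyContinuousOnInterval h a b := by
  have hid : AbsolutelyContinuousOnInterval (fun x : ℝ => x) a b :=
    (LipschitzWith.id.lipschitzOnWith (s := uIcc a b)).absolutelyContinuousOnInterval
  unfold AbsolutelyContinuousOnInterval at hu hid ⊢
  -- On each finite family of disjoint intervals, the increments of `h` sum to at most `K` times
  -- those of `u` plus the total length, and both tend to zero.
  refine squeeze_zero' (.of_forall fun _ => Finset.sum_nonneg fun _ _ => dist_nonneg) ?_
    (by simpa using (hu.add hid).const_mul K)
  rw [eventually_inf_principal]
  filter_upwards with E hE
  rw [← Finset.sum_add_distrib, Finset.mul_sum]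
  exact Finset.sum_le_sum fun i hi => hK _ (hE.1 i hi).1 _ (hE.1 i hi).2

/-- Chain rule and fundamental theorem of calculus along an absolutely continuous curve. -/
lemma integral_fderiv_comp_eq_sub {Φ : ℝ × ℝ → ℝ} (hΦ : ContDiff ℝ 1 Φ) {q u : ℝ → ℝ} {a b : ℝ}
    (hab : a ≤ b) (hq : IntervalIntegrable q volume a b)
    (hu : ∀ x ∈ Icc a b, u x = u a + ∫ t in a..x, q t) :
    ∫ x in a..b, fderiv ℝ Φ (u x, x) (q x, 1) = Φ (u b, b) - Φ (u a, a) := by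
  set v : ℝ → ℝ := fun x => u a + ∫ t in a..x, q t with hv
  have hu' : ∀ x ∈ Icc a b, u x = v x := hu
  have hvac : AbsolutelyContinuousOnInterval v a b := by
    have h1 := hq.absolutelyContinuousOnInterval_intervalIntegral (c := a) left_mem_uIcc
    have h2 : AbsolutelyContinuousOnInterval (fun _ : ℝ => u a) a b :=
      ((LipschitzWith.const (u a)).lipschitzOnWith (s := uIcc a b)).absolutelyContinuousOnInterval
    exact h2.add h1
  obtain ⟨C, hC⟩ := hvac.exists_bound
  -- The curve stays in a compact convex rectangle, where a `C¹` function is Lipschitz; hence `Φ`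
  -- along the curve is absolutely continuous.
  obtain ⟨K, hK⟩ := hΦ.contDiffOn.exists_lipschitzOnWith (s := Icc (-C) C ×ˢ Icc a b) (by decide)
    ((convex_Icc _ _).prod (convex_Icc _ _)) (isCompact_Icc.prod isCompact_Icc)
  have hmem : ∀ x ∈ uIcc a b, (v x, x) ∈ Icc (-C) C ×ˢ Icc a b := by
    intro x hx
    exact ⟨abs_le.1 (hC x hx), by rwa [uIcc_of_le hab] at hx⟩
  have hac : AbsolutelyContinuousOnInterval (fun x => Φ (v x, x)) a b := by
    refine hvac.of_dist_le (K := K) fun x hx y hy => ?_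
    refine (hK.dist_le_mul _ (hmem x hx) _ (hmem y hy)).trans ?_
    gcongr
    rw [Prod.dist_eq]
    exact max_le_add_of_nonneg dist_nonneg dist_nonneg
  have h := hac.integral_deriv_eq_sub
  rw [hu' a (left_mem_Icc.2 hab), hu' b (right_mem_Icc.2 hab), ← h]
  refine intervalIntegral.integral_congr_ae ?_
  filter_upwards [hq.ae_hasDerivAt_integral] with x hx hxm
  have hxm' := uIoc_subset_uIcc hxm
  have h1 : HasDerivAt v (q x) x := by
    simpa [hv] using (hx hxm' a left_mem_uIcc).const_add (u a)
  have h2 : HasFDerivAt Φ (fderiv ℝ Φ (v x, x)) (v x, x) :=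
    (hΦ.differentiable (by decide) _).hasFDerivAt
  rw [hu' x (by rwa [uIcc_of_le hab] at hxm')]
  exact (HasFDerivAt.comp_hasDerivAt (f := fun x => (v x, x)) x h2
    (h1.prodMk (hasDerivAt_id' x))).deriv.symm

/-- A nonzero limit would make `1 / (x - a)` integrable near `a`. This replaces boundary conditions
at `r = 0` and on the axis. -/
lemma eq_zero_of_tendsto_of_integrableOn_div {H : ℝ → ℝ} {a b l : ℝ} (hab : a < b)
    (hH : Tendsto H (𝓝[>] a) (𝓝 l))
    (hint : IntegrableOn (fun x => H x / (x - a)) (Ioo a b)) : l = 0 := by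
  by_contra hl
  have hl' : 0 < |l| := abs_pos.2 hl
  have hev : ∀ᶠ x in 𝓝[>] a, |l| / 2 < |H x| := hH.abs.eventually_const_lt (by linarith)
  obtain ⟨c, hc, hc'⟩ := (mem_nhdsGT_iff_exists_Ioo_subset' hab).1 hev
  have hca : a < c := hc
  set d := min b c with hd
  have had : a < d := lt_min hab hca
  have h1 : IntegrableOn (fun x => H x / (x - a)) (Ioo a d) :=
    hint.mono_set (Ioo_subset_Ioo_right (min_le_left _ _))
  have h2 : IntegrableOn (fun x => (x - a)⁻¹) (Ioo a d) := by
    refine Integrable.mono' (h1.norm.const_mul (2 / |l|)) (by fun_prop) ?_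
    filter_upwards [ae_restrict_mem measurableSet_Ioo] with x hx
    have hx0 : 0 < x - a := by linarith [hx.1]
    have h3 : |l| / 2 < |H x| := hc' ⟨hx.1, hx.2.trans_le (min_le_right _ _)⟩
    rw [Real.norm_eq_abs, Real.norm_eq_abs, abs_div, abs_inv, abs_of_pos hx0]
    rw [div_mul_div_comm, inv_eq_one_div, div_le_div_iff₀ hx0 (by positivity)]
    nlinarith
  have h3 : IntervalIntegrable (fun x => (x - a)⁻¹) volume a d := by
    rw [intervalIntegrable_iff_integrableOn_Ioo_of_le had.le]; exact h2
  rw [intervalIntegrable_sub_inv_iff] at h3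
  rcases h3 with h3 | h3
  · exact had.ne h3
  · exact h3 left_mem_uIcc

/-- Integrability of `h` gives `H` a limit at `a`, and integrability of `H / (x - a)` makes this
limit zero. The value `H a` itself plays no role. -/
lemma integral_eq_of_primitive_left {H h : ℝ → ℝ} {a b : ℝ} (hab : a < b)
    (hH : ∀ x ∈ Ioo a b, ∫ t in x..b, h t = H b - H x) (hh : IntegrableOn h (Ioo a b))
    (hint : IntegrableOn (fun x => H x / (x - a)) (Ioo a b)) :
    ∫ t in a..b, h t = H b := by
  have hi : IntervalIntegrable h volume a b := by
    rwa [intervalIntegrable_iff_integrableOn_Ioo_of_le hab.le]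
  have hcont : ContinuousOn (fun x => ∫ t in x..b, h t) (uIcc a b) :=
    intervalIntegral.continuousOn_primitive_interval_left (by
      rw [uIcc_of_le hab.le, integrableOn_Icc_iff_integrableOn_Ioo]; exact hh)
  have hlim : Tendsto (fun x => ∫ t in x..b, h t) (𝓝[>] a) (𝓝 (∫ t in a..b, h t)) := by
    have := (hcont a left_mem_uIcc).tendsto
    rw [uIcc_of_le hab.le] at this
    refine this.mono_left ?_
    rw [← nhdsWithin_Ioo_eq_nhdsGT hab]
    exact nhdsWithin_mono _ Ioo_subset_Icc_self
  have hlimH : Tendsto H (𝓝[>] a) (𝓝 (H b - ∫ t in a..b, h t)) := by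
    refine (hlim.const_sub (H b)).congr' ?_
    filter_upwards [Ioo_mem_nhdsGT hab] with x hx
    rw [hH x hx]; ring
  linarith [eq_zero_of_tendsto_of_integrableOn_div hab hlimH hint]

lemma integrableOn_Ioo_comp_neg {g : ℝ → ℝ} {a b : ℝ} (hg : IntegrableOn g (Ioo a b)) :
    IntegrableOn (fun x => g (-x)) (Ioo (-b) (-a)) := by
  have := ((Measure.measurePreserving_neg (volume : Measure ℝ)).integrableOn_comp_preimage
    (Homeomorph.neg ℝ).measurableEmbedding).2 hg
  rwa [neg_preimage, neg_Ioo] at this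

lemma integral_eq_of_primitive_right {H h : ℝ → ℝ} {a b : ℝ} (hab : a < b)
    (hH : ∀ x ∈ Ioo a b, ∫ t in a..x, h t = H x - H a) (hh : IntegrableOn h (Ioo a b))
    (hint : IntegrableOn (fun x => H x / (b - x)) (Ioo a b)) :
    ∫ t in a..b, h t = - H a := by
  -- Reflection `x ↦ -x` exchanges the two ends.
  have := integral_eq_of_primitive_left (H := fun x => H (-x)) (h := fun x => - h (-x))
    (neg_lt_neg hab) (fun x hx => ?_) (integrableOn_Ioo_comp_neg hh).neg ?_
  · rw [intervalIntegral.integral_neg, intervalIntegral.integral_comp_neg] at this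
    simp only [neg_neg] at this
    linarith
  · rw [intervalIntegral.integral_neg, intervalIntegral.integral_comp_neg, neg_neg,
      hH (-x) ⟨by linarith [hx.2], by linarith [hx.1]⟩]
    ring
  · refine (integrableOn_Ioo_comp_neg hint).congr (.of_forall fun x => ?_)
    simp only
    ring_nf

lemma integral_eq_zero_of_primitive {H h : ℝ → ℝ} {a b : ℝ} (hab : a < b)
    (hH : ∀ x ∈ Ioo a b, ∀ y ∈ Ioo a b, x ≤ y → ∫ t in x..y, h t = H y - H x)
    (hh : IntegrableOn h (Ioo a b))
    (hl : IntegrableOn (fun x => H x / (x - a)) (Ioo a b))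
    (hr : IntegrableOn (fun x => H x / (b - x)) (Ioo a b)) :
    ∫ t in a..b, h t = 0 := by
  obtain ⟨c, hac, hcb⟩ := exists_between hab
  have h1 : Ioo a c ⊆ Ioo a b := Ioo_subset_Ioo_right hcb.le
  have h2 : Ioo c b ⊆ Ioo a b := Ioo_subset_Ioo_left hac.le
  have i1 := integral_eq_of_primitive_left hac
    (fun x hx => hH x (h1 hx) c ⟨hac, hcb⟩ hx.2.le) (hh.mono_set h1) (hl.mono_set h1)
  have i2 := integral_eq_of_primitive_right hcb
    (fun x hx => hH c ⟨hac, hcb⟩ x (h2 hx) hx.1.le) (hh.mono_set h2) (hr.mono_set h2)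
  have j1 : IntervalIntegrable h volume a c := by
    rw [intervalIntegrable_iff_integrableOn_Ioo_of_le hac.le]; exact hh.mono_set h1
  have j2 : IntervalIntegrable h volume c b := by
    rw [intervalIntegrable_iff_integrableOn_Ioo_of_le hcb.le]; exact hh.mono_set h2
  rw [← intervalIntegral.integral_add_adjacent_intervals j1 j2, i1, i2]
  ring

/-! ### Potentials of the calibrating null Lagrangian -/

/-- Primitive of `sin · modulus`. -/
noncomputable def sinPrimitive (k₁ k₃ x : ℝ) : ℝ := ∫ t in (0 : ℝ)..x, Real.sin t * modulus k₁ k₃ t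

/-- Primitive of `cos · modulus`. -/
noncomputable def cosPrimitive (k₁ k₃ x : ℝ) : ℝ := ∫ t in (0 : ℝ)..x, Real.cos t * modulus k₁ k₃ t

/-- The derivative of `modulus`. -/
noncomputable def modulusDeriv (k₁ k₃ x : ℝ) : ℝ :=
  (k₃ - k₁) * Real.sin x * Real.cos x / modulus k₁ k₃ x

/-- The angular potential of the calibrating null Lagrangian, in terms of `w = ψ - θ`. -/
noncomputable def angularPotential (k₁ k₃ w θ : ℝ) : ℝ :=
  Real.cos θ * sinPrimitive k₁ k₃ w + Real.sin θ * cosPrimitive k₁ k₃ w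

/-- The radial potential of the calibrating null Lagrangian, in terms of `w = ψ - θ`. -/
noncomputable def radialPotential (k₁ k₃ w θ : ℝ) : ℝ :=
  Real.sin (w + θ) * modulus k₁ k₃ w - Real.sin θ * modulus k₁ k₃ 0
    + Real.sin θ * sinPrimitive k₁ k₃ w - Real.cos θ * cosPrimitive k₁ k₃ w

/-- The quadratic form of the derivatives in the reduced energy. -/
noncomputable def quadForm (k₁ k₃ w X Y : ℝ) : ℝ :=
  k₁ * (Real.cos w * Y - Real.sin w * X) ^ 2 + k₃ * (Real.cos w * X + Real.sin w * Y) ^ 2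

lemma fderiv_apply_of_hasDerivAt {Φ : ℝ × ℝ → ℝ} {x y A B : ℝ} (hΦ : DifferentiableAt ℝ Φ (x, y))
    (h1 : HasDerivAt (fun s => Φ (s, y)) A x) (h2 : HasDerivAt (fun s => Φ (x, s)) B y) (a b : ℝ) :
    fderiv ℝ Φ (x, y) (a, b) = a * A + b * B := by
  have e1 : fderiv ℝ Φ (x, y) (1, 0) = A :=
    (HasFDerivAt.comp_hasDerivAt (f := fun s => (s, y)) x hΦ.hasFDerivAt
      ((hasDerivAt_id' x).prodMk (hasDerivAt_const x y))).unique h1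
  have e2 : fderiv ℝ Φ (x, y) (0, 1) = B :=
    (HasFDerivAt.comp_hasDerivAt (f := fun s => (x, s)) y hΦ.hasFDerivAt
      ((hasDerivAt_const y x).prodMk (hasDerivAt_id' y))).unique h2
  have : ((a, b) : ℝ × ℝ) = a • (1, 0) + b • (0, 1) := by simp
  rw [this, map_add, map_smul, map_smul, e1, e2, smul_eq_mul, smul_eq_mul]

variable {k₁ k₃ : ℝ}

lemma hasDerivAt_sinPrimitive (x : ℝ) :
    HasDerivAt (sinPrimitive k₁ k₃) (Real.sin x * modulus k₁ k₃ x) x :=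
  intervalIntegral.integral_hasDerivAt_right
    ((Real.continuous_sin.mul continuous_modulus).intervalIntegrable _ _)
    (Real.continuous_sin.mul continuous_modulus).stronglyMeasurable.stronglyMeasurableAtFilter
    (Real.continuous_sin.mul continuous_modulus).continuousAt

lemma hasDerivAt_cosPrimitive (x : ℝ) :
    HasDerivAt (cosPrimitive k₁ k₃) (Real.cos x * modulus k₁ k₃ x) x :=
  intervalIntegral.integral_hasDerivAt_right
    ((Real.continuous_cos.mul continuous_modulus).intervalIntegrable _ _)
    (Real.continuous_cos.mul continuous_modulus).stronglyMeasurable.stronglyMeasurableAtFilter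
    (Real.continuous_cos.mul continuous_modulus).continuousAt

lemma contDiff_sinPrimitive : ContDiff ℝ 1 (sinPrimitive k₁ k₃) := by
  rw [contDiff_one_iff_deriv]
  refine ⟨fun x => (hasDerivAt_sinPrimitive x).differentiableAt, ?_⟩
  rw [funext fun x => (hasDerivAt_sinPrimitive (k₁ := k₁) (k₃ := k₃) x).deriv]
  exact Real.continuous_sin.mul continuous_modulus

lemma contDiff_cosPrimitive : ContDiff ℝ 1 (cosPrimitive k₁ k₃) := by
  rw [contDiff_one_iff_deriv]
  refine ⟨fun x => (hasDerivAt_cosPrimitive x).differentiableAt, ?_⟩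
  rw [funext fun x => (hasDerivAt_cosPrimitive (k₁ := k₁) (k₃ := k₃) x).deriv]
  exact Real.continuous_cos.mul continuous_modulus

lemma contDiff_angularPotential :
    ContDiff ℝ 1 (fun x : ℝ × ℝ => angularPotential k₁ k₃ x.1 x.2) := by
  have h1 := contDiff_sinPrimitive (k₁ := k₁) (k₃ := k₃)
  have h2 := contDiff_cosPrimitive (k₁ := k₁) (k₃ := k₃)
  unfold angularPotential
  fun_prop

lemma modulus_zero : modulus k₁ k₃ 0 = √k₁ := by simp [modulus]

/-- The direction `(a - 1, 1)` is the velocity of `θ ↦ (ψ - θ, θ)` when `a = ∂_θ ψ`. The terms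
without `a` make up the radial potential, up to the normalization `sin θ √k₁` that lets the latter
vanish at `w = 0`. -/
lemma fderiv_angularPotential (w θ a : ℝ) :
    fderiv ℝ (fun x : ℝ × ℝ => angularPotential k₁ k₃ x.1 x.2) (w, θ) (a - 1, 1)
      = Real.sin (w + θ) * modulus k₁ k₃ w * a - radialPotential k₁ k₃ w θ - Real.sin θ * √k₁ := by
  have h1 : HasDerivAt (fun w => angularPotential k₁ k₃ w θ)
      (Real.cos θ * (Real.sin w * modulus k₁ k₃ w)
        + Real.sin θ * (Real.cos w * modulus k₁ k₃ w)) w :=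
    ((hasDerivAt_sinPrimitive w).const_mul _).add ((hasDerivAt_cosPrimitive w).const_mul _)
  have h2 : HasDerivAt (fun θ => angularPotential k₁ k₃ w θ)
      (-Real.sin θ * sinPrimitive k₁ k₃ w + Real.cos θ * cosPrimitive k₁ k₃ w) θ :=
    ((Real.hasDerivAt_cos θ).mul_const _).add ((Real.hasDerivAt_sin θ).mul_const _)
  rw [fderiv_apply_of_hasDerivAt (contDiff_angularPotential.differentiable (by decide) _) h1 h2]
  simp only [radialPotential, modulus_zero, Real.sin_add]
  ring

/-! ### Estimates for the potentials and the calibration identity -/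

section bounds

lemma abs_modulus_le (x : ℝ) : |modulus k₁ k₃ x| ≤ √(max k₁ k₃) := by
  rw [modulus, abs_of_nonneg (Real.sqrt_nonneg _)]
  exact modulus_le x

/-- Since `|sin t| ≤ |t|`, one factor `x` is gained over the trivial bound. It is needed where the
coefficient `cos θ` does not vanish on the axis. -/
lemma abs_sinPrimitive_le_sq (x : ℝ) : |sinPrimitive k₁ k₃ x| ≤ √(max k₁ k₃) * x ^ 2 := by
  have := intervalIntegral.norm_integral_le_of_norm_le_const (a := 0) (b := x)
    (f := fun t => Real.sin t * modulus k₁ k₃ t) (C := |x| * √(max k₁ k₃)) fun t ht => by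
      rw [norm_mul, Real.norm_eq_abs, Real.norm_eq_abs]
      have h1 : |t| ≤ |x| := by
        have := abs_sub_left_of_mem_uIcc (uIoc_subset_uIcc ht)
        simpa using this
      have h2 : |Real.sin t| ≤ |t| := Real.abs_sin_le_abs
      exact mul_le_mul (h2.trans h1) (abs_modulus_le t) (abs_nonneg _) (abs_nonneg _)
  refine this.trans_eq ?_
  rw [sub_zero, ← sq_abs]; ring

lemma abs_sinPrimitive_le (x : ℝ) : |sinPrimitive k₁ k₃ x| ≤ √(max k₁ k₃) * |x| := by
  have := intervalIntegral.norm_integral_le_of_norm_le_const (a := 0) (b := x)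
    (f := fun t => Real.sin t * modulus k₁ k₃ t) (C := 1 * √(max k₁ k₃)) fun t _ => by
      rw [norm_mul, Real.norm_eq_abs, Real.norm_eq_abs]
      exact mul_le_mul (Real.abs_sin_le_one t) (abs_modulus_le t) (abs_nonneg _) zero_le_one
  refine this.trans_eq ?_
  rw [sub_zero]; ring

lemma abs_cosPrimitive_le (x : ℝ) : |cosPrimitive k₁ k₃ x| ≤ √(max k₁ k₃) * |x| := by
  have := intervalIntegral.norm_integral_le_of_norm_le_const (a := 0) (b := x)
    (f := fun t => Real.cos t * modulus k₁ k₃ t) (C := 1 * √(max k₁ k₃)) fun t _ => by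
      rw [norm_mul, Real.norm_eq_abs, Real.norm_eq_abs]
      exact mul_le_mul (Real.abs_cos_le_one t) (abs_modulus_le t) (abs_nonneg _) zero_le_one
  refine this.trans_eq ?_
  rw [sub_zero]; ring

/-- After division by `sin θ` the right-hand side is `w² / sin θ + |w|` up to a constant, which
finite energy controls. -/
lemma abs_angularPotential_le (w θ : ℝ) :
    |angularPotential k₁ k₃ w θ| ≤ √(max k₁ k₃) * (w ^ 2 + |w| * |Real.sin θ|) := by
  unfold angularPotential
  calc _ ≤ |Real.cos θ| * |sinPrimitive k₁ k₃ w| + |Real.sin θ| * |cosPrimitive k₁ k₃ w| := by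
        rw [← abs_mul, ← abs_mul]; exact abs_add_le _ _
    _ ≤ 1 * (√(max k₁ k₃) * w ^ 2) + |Real.sin θ| * (√(max k₁ k₃) * |w|) := by
        gcongr
        · exact Real.abs_cos_le_one θ
        · exact abs_sinPrimitive_le_sq w
        · exact abs_cosPrimitive_le w
    _ = _ := by ring

lemma abs_sin_add_sub_sin_le (w θ : ℝ) : |Real.sin (w + θ) - Real.sin θ| ≤ |w| := by
  have := Real.abs_sin_sub_sin_le (w + θ) θ
  simpa using this

variable (hk₁ : 0 < k₁) (hk₃ : 0 < k₃)

include hk₁ hk₃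

lemma abs_modulusDeriv_le (x : ℝ) : |modulusDeriv k₁ k₃ x| ≤ |k₃ - k₁| / √(min k₁ k₃) := by
  have hm := modulus_pos hk₁ hk₃ x
  rw [modulusDeriv, abs_div, abs_of_pos hm]
  refine div_le_div₀ (abs_nonneg _) ?_ (Real.sqrt_pos.2 (lt_min hk₁ hk₃)) (sqrt_min_le_modulus x)
  rw [abs_mul, abs_mul]
  calc _ ≤ |k₃ - k₁| * 1 * 1 := by
        gcongr
        · exact Real.abs_sin_le_one _
        · exact Real.abs_cos_le_one _
    _ = _ := by ring

lemma abs_modulus_sub_le (x : ℝ) :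
    |modulus k₁ k₃ x - modulus k₁ k₃ 0| ≤ |k₃ - k₁| / √(min k₁ k₃) * |x| := by
  have := convex_univ.norm_image_sub_le_of_norm_hasDerivWithin_le (f := modulus k₁ k₃)
    (f' := modulusDeriv k₁ k₃) (C := |k₃ - k₁| / √(min k₁ k₃))
    (fun x _ => (hasDerivAt_modulus hk₁ hk₃ x).hasDerivWithinAt)
    (fun x _ => abs_modulusDeriv_le hk₁ hk₃ x) (mem_univ 0) (mem_univ x)
  simpa using this

lemma abs_radialPotential_le (w θ : ℝ) :
    |radialPotential k₁ k₃ w θ| ≤ (3 * √(max k₁ k₃) + |k₃ - k₁| / √(min k₁ k₃)) * |w| := by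
  -- Regrouped so that each term visibly vanishes to first order at `w = 0`.
  have e : radialPotential k₁ k₃ w θ = (Real.sin (w + θ) - Real.sin θ) * modulus k₁ k₃ w
      + Real.sin θ * (modulus k₁ k₃ w - modulus k₁ k₃ 0)
      + Real.sin θ * sinPrimitive k₁ k₃ w - Real.cos θ * cosPrimitive k₁ k₃ w := by
    unfold radialPotential; ring
  have h1 : |(Real.sin (w + θ) - Real.sin θ) * modulus k₁ k₃ w| ≤ |w| * √(max k₁ k₃) := by
    rw [abs_mul]
    exact mul_le_mul (abs_sin_add_sub_sin_le w θ) (abs_modulus_le w) (abs_nonneg _) (abs_nonneg _)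
  have h2 : |Real.sin θ * (modulus k₁ k₃ w - modulus k₁ k₃ 0)|
      ≤ 1 * (|k₃ - k₁| / √(min k₁ k₃) * |w|) := by
    rw [abs_mul]
    exact mul_le_mul (Real.abs_sin_le_one θ) (abs_modulus_sub_le hk₁ hk₃ w) (abs_nonneg _)
      zero_le_one
  have h3 : |Real.sin θ * sinPrimitive k₁ k₃ w| ≤ 1 * (√(max k₁ k₃) * |w|) := by
    rw [abs_mul]
    exact mul_le_mul (Real.abs_sin_le_one θ) (abs_sinPrimitive_le w) (abs_nonneg _) zero_le_one
  have h4 : |Real.cos θ * cosPrimitive k₁ k₃ w| ≤ 1 * (√(max k₁ k₃) * |w|) := by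
    rw [abs_mul]
    exact mul_le_mul (Real.abs_cos_le_one θ) (abs_cosPrimitive_le w) (abs_nonneg _) zero_le_one
  rw [e]
  refine (abs_sub _ _).trans ?_
  refine (add_le_add_left (abs_add_three _ _ _) _).trans ?_
  linarith

/-- The term `cos (w + θ) * modulus` from the product rule cancels against the derivatives of the
two primitives, by the addition formula. -/
lemma hasDerivAt_radialPotential (w θ : ℝ) :
    HasDerivAt (fun w => radialPotential k₁ k₃ w θ)
      (Real.sin (w + θ) * modulusDeriv k₁ k₃ w) w := by
  have h1 : HasDerivAt (fun w => Real.sin (w + θ)) (Real.cos (w + θ)) w := by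
    simpa using ((hasDerivAt_id' w).add_const θ).sin
  have h := (((h1.mul (hasDerivAt_modulus hk₁ hk₃ w)).sub_const (Real.sin θ * modulus k₁ k₃ 0)).add
    ((hasDerivAt_sinPrimitive (k₁ := k₁) (k₃ := k₃) w).const_mul (Real.sin θ))).sub
    ((hasDerivAt_cosPrimitive (k₁ := k₁) (k₃ := k₃) w).const_mul (Real.cos θ))
  refine h.congr_deriv ?_
  simp only [modulusDeriv, Real.cos_add]
  ring

lemma contDiff_modulus : ContDiff ℝ 1 (modulus k₁ k₃) := by
  unfold modulus
  refine ContDiff.sqrt (by fun_prop) fun x => (combination_pos hk₁ hk₃ x).ne'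

lemma contDiff_radialPotential (θ : ℝ) : ContDiff ℝ 1 (fun w => radialPotential k₁ k₃ w θ) := by
  have h1 := contDiff_sinPrimitive (k₁ := k₁) (k₃ := k₃)
  have h2 := contDiff_cosPrimitive (k₁ := k₁) (k₃ := k₃)
  have h3 := contDiff_modulus hk₁ hk₃
  unfold radialPotential
  fun_prop

lemma contDiff_mul_radialPotential (θ : ℝ) :
    ContDiff ℝ 1 (fun x : ℝ × ℝ => x.2 * radialPotential k₁ k₃ x.1 θ) :=
  contDiff_snd.mul ((contDiff_radialPotential hk₁ hk₃ θ).comp contDiff_fst)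

lemma fderiv_mul_radialPotential (θ w r a : ℝ) :
    fderiv ℝ (fun x : ℝ × ℝ => x.2 * radialPotential k₁ k₃ x.1 θ) (w, r) (a, 1)
      = r * Real.sin (w + θ) * modulusDeriv k₁ k₃ w * a + radialPotential k₁ k₃ w θ := by
  have h1 : HasDerivAt (fun w => r * radialPotential k₁ k₃ w θ)
      (r * (Real.sin (w + θ) * modulusDeriv k₁ k₃ w)) w :=
    (hasDerivAt_radialPotential hk₁ hk₃ w θ).const_mul r
  have h2 : HasDerivAt (fun r => r * radialPotential k₁ k₃ w θ)
      (1 * radialPotential k₁ k₃ w θ) r := (hasDerivAt_id' r).mul_const _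
  rw [fderiv_apply_of_hasDerivAt
    ((contDiff_mul_radialPotential hk₁ hk₃ θ).differentiable (by decide) _) h1 h2]
  ring

/-- Complete the square around `q = slope`. The cross term of the square with `slope` yields the
`modulusDeriv` term, the product `q * slope` yields the `modulus` term, and the square of `slope` is
the potential term `k₁ sin² s / sin² θ`. The radial potential is added and subtracted so that each
half becomes an exact derivative. -/
lemma density_mul_eq {r θ : ℝ} (hr : 0 < r) (hθ : 0 < Real.sin θ) (s p q : ℝ) :
    density k₁ k₃ r θ s p q * (r ^ 2 * Real.sin θ)
      = 2 * √k₁ * ((r * Real.sin s * modulusDeriv k₁ k₃ (s - θ) * p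
          + radialPotential k₁ k₃ (s - θ) θ)
          + (Real.sin s * modulus k₁ k₃ (s - θ) * q - radialPotential k₁ k₃ (s - θ) θ))
        + Real.sin θ * quadForm k₁ k₃ (s - θ) (r * p) (q - slope k₁ k₃ θ s) := by
  have hm := modulus_pos hk₁ hk₃ (s - θ)
  have hm2 := modulus_sq hk₁ hk₃ (s - θ)
  have hk := Real.sq_sqrt hk₁.le
  set m := modulus k₁ k₃ (s - θ) with hmdef
  set S := Real.sin (s - θ)
  set C := Real.cos (s - θ)
  have e : quadForm k₁ k₃ (s - θ) (r * p) (q - slope k₁ k₃ θ s)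
      = (k₁ * S ^ 2 + k₃ * C ^ 2) * (r * p) ^ 2
        - 2 * (k₁ - k₃) * S * C * (r * p) * (q - slope k₁ k₃ θ s)
        + m ^ 2 * (q - slope k₁ k₃ θ s) ^ 2 := by
    rw [hm2]; simp only [quadForm]; ring
  have e2 : slope k₁ k₃ θ s = √k₁ * Real.sin s / (Real.sin θ * m) := rfl
  have e3 : modulusDeriv k₁ k₃ (s - θ) = (k₃ - k₁) * S * C / m := rfl
  have e4 : density k₁ k₃ r θ s p q = (k₁ * S ^ 2 + k₃ * C ^ 2) * p ^ 2
      + 1 / r ^ 2 * m ^ 2 * q ^ 2 - 2 * (k₁ - k₃) / r * S * C * p * q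
      + √k₁ ^ 2 / r ^ 2 * (1 / Real.sin θ ^ 2) * Real.sin s ^ 2 := by
    rw [hm2, hk]; rfl
  rw [e, e2, e3, e4]
  field_simp
  ring

lemma quadForm_nonneg (w X Y : ℝ) : 0 ≤ quadForm k₁ k₃ w X Y := by
  unfold quadForm; positivity

/-- The two squared expressions are the components of `(X, Y)` in a rotated frame. Only `X` is
needed: `∂_r ψ = 0` and the trace already determine `ψ`. -/
lemma eq_zero_of_quadForm_eq_zero {w X Y : ℝ} (h : quadForm k₁ k₃ w X Y = 0) : X = 0 := by
  unfold quadForm at h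
  have h1 : k₁ * (Real.cos w * Y - Real.sin w * X) ^ 2 = 0 := by
    nlinarith [mul_nonneg hk₁.le (sq_nonneg (Real.cos w * Y - Real.sin w * X)),
      mul_nonneg hk₃.le (sq_nonneg (Real.cos w * X + Real.sin w * Y))]
  have h2 : k₃ * (Real.cos w * X + Real.sin w * Y) ^ 2 = 0 := by linarith
  have h3 : Real.cos w * Y - Real.sin w * X = 0 := by simpa [hk₁.ne'] using h1
  have h4 : Real.cos w * X + Real.sin w * Y = 0 := by simpa [hk₃.ne'] using h2
  linear_combination (-Real.sin w) * h3 + Real.cos w * h4 - X * Real.sin_sq_add_cos_sq w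

end bounds

/-! ### Slicing of rectangles, and primitives in the first variable -/

lemma restrict_prod (s t : Set ℝ) :
    (volume.restrict (s ×ˢ t) : Measure (ℝ × ℝ))
      = (volume.restrict s).prod (volume.restrict t) := by
  rw [Measure.volume_eq_prod, Measure.prod_restrict]

lemma ae_snd_of_ae {s t : Set ℝ} {p : ℝ × ℝ → Prop} (h : ∀ᵐ z ∂volume.restrict (s ×ˢ t), p z) :
    ∀ᵐ y ∂volume.restrict t, ∀ᵐ x ∂volume.restrict s, p (x, y) := by
  rw [restrict_prod, ← Measure.prod_swap] at h
  exact Measure.ae_ae_of_ae_prod (ae_of_ae_map measurable_swap.aemeasurable h)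

lemma ae_comp_snd {s t : Set ℝ} {p : ℝ → Prop} (h : ∀ᵐ y ∂volume.restrict t, p y) :
    ∀ᵐ z ∂(volume.restrict (s ×ˢ t) : Measure (ℝ × ℝ)), p z.2 := by
  rw [restrict_prod]
  exact Measure.quasiMeasurePreserving_snd.ae h

lemma setIntegral_rect {s t : Set ℝ} {F : ℝ × ℝ → ℝ} (hF : IntegrableOn F (s ×ˢ t)) :
    ∫ z in s ×ˢ t, F z = ∫ y in t, ∫ x in s, F (x, y) := by
  rw [IntegrableOn, restrict_prod] at hF
  rw [restrict_prod, integral_prod_symm _ hF]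

/-- The primitive of `κ` in the first variable, vanishing at `a`. -/
noncomputable def primitive (a : ℝ) (κ : ℝ × ℝ → ℝ) (z : ℝ × ℝ) : ℝ := ∫ s in a..z.1, κ (s, z.2)

section primitive

variable {a b c d : ℝ}

/-- The primitive is the convolution in the first variable with the Heaviside function, and the
second variable enters as a smooth parameter. -/
lemma contDiff_primitive {κ : ℝ × ℝ → ℝ} (hκ : ContDiff ℝ ∞ κ) (hc : HasCompactSupport κ)
    (ha : ∀ s ≤ a, ∀ y, κ (s, y) = 0) : ContDiff ℝ ∞ (primitive a κ) := by
  have hk : IsCompact (Prod.fst '' tsupport κ) := hc.isCompact.image continuous_fst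
  have hz : ∀ x, x ∉ Prod.fst '' tsupport κ → ∀ y, κ (x, y) = 0 := fun x hx y =>
    image_eq_zero_of_notMem_tsupport fun h => hx ⟨_, h, rfl⟩
  have hf : LocallyIntegrable ((Ioi (0 : ℝ)).indicator fun _ => (1 : ℝ)) :=
    (locallyIntegrable_const 1).indicator measurableSet_Ioi
  have h := contDiffOn_convolution_right_with_param (n := ⊤) (μ := (volume : Measure ℝ))
    (ContinuousLinearMap.mul ℝ ℝ) (g := fun y x => κ (x, y)) (s := (univ : Set ℝ))
    isOpen_univ hk (fun y x _ hx => hz x hx y) hf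
    (hκ.comp (contDiff_snd.prodMk contDiff_fst)).contDiffOn
  rw [univ_prod_univ, contDiffOn_univ] at h
  have h2 := h.comp (contDiff_snd.prodMk contDiff_fst : ContDiff ℝ ∞ fun z : ℝ × ℝ => (z.2, z.1))
  convert! h2 using 1
  funext z
  have hint : Integrable (fun s => κ (s, z.2)) := by
    refine (hκ.continuous.comp (by fun_prop)).integrable_of_hasCompactSupport ?_
    exact HasCompactSupport.intro hk fun x hx => hz x hx _
  simp only [Function.comp, primitive]
  rw [convolution_eq_swap]
  have e1 : ∀ t, ((ContinuousLinearMap.mul ℝ ℝ)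
      ((Ioi (0 : ℝ)).indicator (fun _ => (1 : ℝ)) (z.1 - t))) (κ (t, z.2))
      = (Iio z.1).indicator (fun s => κ (s, z.2)) t := by
    intro t
    by_cases ht : t < z.1
    · simp [indicator, ht]
    · simp [indicator, ht]
  simp_rw [e1]
  rw [integral_indicator measurableSet_Iio, ← integral_Iic_eq_integral_Iio,
    ← intervalIntegral.integral_Iic_sub_Iic hint.integrableOn hint.integrableOn,
    setIntegral_eq_zero_of_forall_eq_zero (t := Iic a) (fun s hs => ha s hs _), sub_zero]

lemma exists_Icc_of_isCompact_subset_Ioo {K : Set ℝ} (hK : IsCompact K) (h : K ⊆ Ioo a b) :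
    ∃ a' b', a < a' ∧ b' < b ∧ K ⊆ Icc a' b' := by
  rcases K.eq_empty_or_nonempty with rfl | hne
  · exact ⟨a + 1, b - 1, by linarith, by linarith, empty_subset _⟩
  · exact ⟨sInf K, sSup K, (h (hK.sInf_mem hne)).1, (h (hK.sSup_mem hne)).2,
      fun x hx => ⟨csInf_le hK.bddBelow hx, le_csSup hK.bddAbove hx⟩⟩

lemma hasDerivAt_primitive {κ : ℝ × ℝ → ℝ} (hκ : Continuous κ) (x y : ℝ) :
    HasDerivAt (fun x => primitive a κ (x, y)) (κ (x, y)) x := by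
  have hc : Continuous fun s => κ (s, y) := hκ.comp (by fun_prop)
  exact intervalIntegral.integral_hasDerivAt_right (hc.intervalIntegrable _ _)
    hc.stronglyMeasurable.stronglyMeasurableAtFilter hc.continuousAt

/-- To the left of the support of `κ` the primitive is zero, and to the right it is the full
integral over the row, which vanishes by `h0`. So the primitive is itself an admissible test
function. -/
lemma primitive_facts {κ : ℝ × ℝ → ℝ} (hκ : ContDiff ℝ ∞ κ) (hc : HasCompactSupport κ)
    (hs : tsupport κ ⊆ Ioo a b ×ˢ Ioo c d) (h0 : ∀ y, ∫ s in a..b, κ (s, y) = 0) :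
    ContDiff ℝ ∞ (primitive a κ) ∧ HasCompactSupport (primitive a κ) ∧
      tsupport (primitive a κ) ⊆ Ioo a b ×ˢ Ioo c d := by
  have hk1 : IsCompact (Prod.fst '' tsupport κ) := hc.isCompact.image continuous_fst
  have hk2 : IsCompact (Prod.snd '' tsupport κ) := hc.isCompact.image continuous_snd
  obtain ⟨a', b', haa, hbb, hab⟩ := exists_Icc_of_isCompact_subset_Ioo (a := a) (b := b) hk1 (by
    rintro _ ⟨z, hz, rfl⟩; exact (hs hz).1)
  have hz1 : ∀ s, s ∉ Icc a' b' → ∀ y, κ (s, y) = 0 := fun s h y =>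
    image_eq_zero_of_notMem_tsupport fun h' => h (hab ⟨_, h', rfl⟩)
  have hz2 : ∀ y, y ∉ Prod.snd '' tsupport κ → ∀ s, κ (s, y) = 0 := fun y h s =>
    image_eq_zero_of_notMem_tsupport fun h' => h ⟨_, h', rfl⟩
  have hsm := contDiff_primitive (a := a) hκ hc fun s hsa y => hz1 s (fun h => by
    linarith [h.1]) y
  have hsub : Function.support (primitive a κ) ⊆ Icc a' b' ×ˢ (Prod.snd '' tsupport κ) := by
    intro z hz
    by_contra hcon
    refine hz ?_
    rw [mem_prod, not_and_or] at hcon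
    have hconst : ∀ x y, (∀ s ∈ uIoc x y, κ (s, z.2) = 0) → ∫ s in x..y, κ (s, z.2) = 0 :=
      fun x y h => intervalIntegral.integral_zero_ae (.of_forall h)
    have hci : Continuous fun s => κ (s, z.2) := hκ.continuous.comp (by fun_prop)
    rcases hcon with h | h
    · rcases not_and_or.1 h with h | h
      · exact hconst _ _ fun s hs => hz1 s (fun h' => by
          have := hs.2; rcases le_max_iff.1 this with h1 | h1 <;> linarith [h'.1]) _
      · have e : primitive a κ z = (∫ s in a..b, κ (s, z.2)) + ∫ s in b..z.1, κ (s, z.2) :=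
          (intervalIntegral.integral_add_adjacent_intervals (hci.intervalIntegrable _ _)
            (hci.intervalIntegrable _ _)).symm
        rw [e, h0, zero_add]
        exact hconst _ _ fun s hs => hz1 s (fun h' => by
          have := hs.1; rcases min_lt_iff.1 this with h1 | h1 <;> linarith [h'.2]) _
    · exact hconst _ _ fun s _ => hz2 _ h s
  have hcomp : IsCompact (Icc a' b' ×ˢ (Prod.snd '' tsupport κ)) := isCompact_Icc.prod hk2
  refine ⟨hsm, HasCompactSupport.of_support_subset_isCompact hcomp hsub, ?_⟩
  refine (closure_minimal hsub hcomp.isClosed).trans (prod_mono ?_ ?_)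
  · exact fun x hx => ⟨haa.trans_le hx.1, hx.2.trans_lt hbb⟩
  · rintro _ ⟨z, hz, rfl⟩; exact (hs hz).2

lemma fderiv_primitive {κ : ℝ × ℝ → ℝ} (hκ : Continuous κ) (hd : Differentiable ℝ (primitive a κ))
    (z : ℝ × ℝ) : fderiv ℝ (primitive a κ) z eR = κ z := by
  have h := HasFDerivAt.comp_hasDerivAt (f := fun s => (s, z.2)) z.1 (hd z).hasFDerivAt
    ((hasDerivAt_id' z.1).prodMk (hasDerivAt_const z.1 z.2))
  exact h.unique (hasDerivAt_primitive hκ z.1 z.2)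

/-- Domination by `∫ |g(·, y)|`, which does not depend on the first variable and is integrable by
Fubini. -/
lemma integrableOn_primitive {g : ℝ × ℝ → ℝ} (hg : IntegrableOn g (Ioo a b ×ˢ Ioo c d)) :
    IntegrableOn (primitive a g) (Ioo a b ×ˢ Ioo c d) := by
  have hg0 := hg
  rw [IntegrableOn, restrict_prod] at hg
  have hB := (hg.norm.integral_prod_right).comp_snd (volume.restrict (Ioo a b))
  rw [← restrict_prod] at hB
  have hsec : ∀ᵐ z ∂volume.restrict (Ioo a b ×ˢ Ioo c d),
      IntegrableOn (fun x => g (x, z.2)) (Ioo a b) := ae_comp_snd hg.prod_left_ae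
  refine hB.mono' ?_ ?_
  -- Measurability: replace `g` by a measurable representative and write the primitive as a
  -- parameter integral with the indicator of `a < s ≤ x`.
  · obtain ⟨g', hg', hgg⟩ := hg0.1
    have hm : StronglyMeasurable fun p : (ℝ × ℝ) × ℝ =>
        {p : (ℝ × ℝ) × ℝ | a < p.2 ∧ p.2 ≤ p.1.1}.indicator (fun p => g' (p.2, p.1.2)) p := by
      refine (hg'.comp_measurable (by fun_prop)).indicator ?_
      exact (measurableSet_lt measurable_const measurable_snd).inter
        (measurableSet_le measurable_snd (by fun_prop))
    refine ⟨_, hm.integral_prod_right' (ν := volume), ?_⟩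
    filter_upwards [ae_restrict_mem (measurableSet_Ioo.prod measurableSet_Ioo),
      ae_comp_snd (s := Ioo a b) (ae_snd_of_ae hgg)] with z hz hz'
    have haz : a ≤ z.1 := hz.1.1.le
    rw [primitive, intervalIntegral.integral_of_le haz, ← integral_indicator measurableSet_Ioc]
    refine integral_congr_ae ?_
    have h1 := (ae_restrict_iff' measurableSet_Ioo).1 hz'
    filter_upwards [h1] with s hs
    by_cases hsz : a < s ∧ s ≤ z.1
    · rw [indicator_of_mem (show s ∈ Ioc a z.1 from hsz),
        indicator_of_mem (show (z, s) ∈ {p : (ℝ × ℝ) × ℝ | a < p.2 ∧ p.2 ≤ p.1.1} from hsz)]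
      exact hs ⟨hsz.1, hsz.2.trans_lt hz.1.2⟩
    · rw [indicator_of_notMem (show s ∉ Ioc a z.1 from hsz),
        indicator_of_notMem (show (z, s) ∉ {p : (ℝ × ℝ) × ℝ | a < p.2 ∧ p.2 ≤ p.1.1} from hsz)]
  · filter_upwards [ae_restrict_mem (measurableSet_Ioo.prod measurableSet_Ioo), hsec] with z hz hi
    have haz : a ≤ z.1 := hz.1.1.le
    rw [primitive, intervalIntegral.integral_of_le haz]
    refine (norm_integral_le_integral_norm _).trans ?_
    exact setIntegral_mono_set hi.norm (.of_forall fun _ => norm_nonneg _)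
      (Ioc_subset_Ioo_right hz.1.2).eventuallyLE

/-- Integration by parts for absolutely continuous functions; both primitives vanish at `a`, and
that of `κ` also at `b`. -/
lemma integral_mul_primitive {g κ : ℝ → ℝ} (hab : a ≤ b) (hg : IntegrableOn g (Ioo a b))
    (hκ : Continuous κ) (h0 : ∫ s in a..b, κ s = 0) :
    ∫ x in Ioo a b, g x * ∫ s in a..x, κ s = - ∫ x in Ioo a b, (∫ s in a..x, g s) * κ x := by
  have hgi : IntervalIntegrable g volume a b := by
    rwa [intervalIntegrable_iff_integrableOn_Ioo_of_le hab]
  have hκi : IntervalIntegrable κ volume a b := hκ.intervalIntegrable _ _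
  have h1 := hgi.absolutelyContinuousOnInterval_intervalIntegral (c := a) left_mem_uIcc
  have h2 := hκi.absolutelyContinuousOnInterval_intervalIntegral (c := a) left_mem_uIcc
  have h := h1.integral_mul_deriv_eq_deriv_mul h2
  simp only [h0, intervalIntegral.integral_same, mul_zero, sub_zero, zero_sub] at h
  have e1 : ∫ x in a..b, (∫ s in a..x, g s) * deriv (fun x => ∫ s in a..x, κ s) x
      = ∫ x in a..b, (∫ s in a..x, g s) * κ x :=
    intervalIntegral.integral_congr fun x _ => by
      simp only [hκ.deriv_integral]
  have e2 : ∫ x in a..b, deriv (fun x => ∫ s in a..x, g s) x * (∫ s in a..x, κ s)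
      = ∫ x in a..b, g x * ∫ s in a..x, κ s := by
    refine intervalIntegral.integral_congr_ae ?_
    filter_upwards [hgi.ae_hasDerivAt_integral] with x hx hxm
    rw [(hx (uIoc_subset_uIcc hxm) a left_mem_uIcc).deriv]
  rw [e1, e2] at h
  rw [← integral_Ioc_eq_integral_Ioo, ← integral_Ioc_eq_integral_Ioo,
    ← intervalIntegral.integral_of_le hab, ← intervalIntegral.integral_of_le hab]
  linarith

end primitive

/-! ### Absolute continuity on almost every line -/

section line

variable {a b c d : ℝ}

lemma exists_unit_bump (hab : a < b) : ∃ ζ : ℝ → ℝ, ContDiff ℝ ∞ ζ ∧ HasCompactSupport ζ ∧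
    tsupport ζ ⊆ Ioo a b ∧ ∫ x in a..b, ζ x = 1 := by
  let f : ContDiffBump ((a + b) / 2) := ⟨(b - a) / 8, (b - a) / 4, by linarith, by linarith⟩
  have hs : tsupport (f.normed volume) ⊆ Ioo a b := by
    rw [f.tsupport_normed_eq, Real.closedBall_eq_Icc]
    intro x hx
    simp only [f, mem_Icc] at hx
    exact ⟨by linarith, by linarith⟩
  refine ⟨f.normed volume, f.contDiff_normed, f.hasCompactSupport_normed, hs, ?_⟩
  rw [intervalIntegral.integral_of_le hab.le, setIntegral_eq_integral_of_forall_compl_eq_zero,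
    f.integral_normed]
  intro x hx
  exact image_eq_zero_of_notMem_tsupport fun h => hx (Ioo_subset_Ioc_self (hs h))

lemma _root_.MeasureTheory.IntegrableOn.mul_of_continuous_bounded {s : Set (ℝ × ℝ)}
    {F φ : ℝ × ℝ → ℝ} (hF : IntegrableOn F s) (hφ : Continuous φ) {C : ℝ} (hC : ∀ z, ‖φ z‖ ≤ C) :
    IntegrableOn (fun z => F z * φ z) s :=
  Integrable.mul_bdd hF hφ.aestronglyMeasurable (.of_forall hC)

/-- A function on a rectangle whose weak derivative in the first variable is `g` is, up to a
function of the second variable, the primitive of `g`. -/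
theorem exists_ae_eq_add_primitive (hab : a < b) {u g : ℝ × ℝ → ℝ}
    (hu : IntegrableOn u (Ioo a b ×ˢ Ioo c d)) (hg : IntegrableOn g (Ioo a b ×ˢ Ioo c d))
    (hw : ∀ φ : ℝ × ℝ → ℝ, ContDiff ℝ ∞ φ → HasCompactSupport φ →
      tsupport φ ⊆ Ioo a b ×ˢ Ioo c d →
      ∫ z in Ioo a b ×ˢ Ioo c d, u z * fderiv ℝ φ z eR
        = - ∫ z in Ioo a b ×ˢ Ioo c d, g z * φ z) :
    ∃ C : ℝ → ℝ, ∀ᵐ z ∂volume.restrict (Ioo a b ×ˢ Ioo c d),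
      u z = C z.2 + primitive a g z := by
  set U := Ioo a b ×ˢ Ioo c d with hU
  have hUo : IsOpen U := isOpen_Ioo.prod isOpen_Ioo
  obtain ⟨ζ, hζ, hζc, hζs, hζ1⟩ := exists_unit_bump hab
  have hΓ := integrableOn_primitive hg
  have hv : IntegrableOn (fun z => u z - primitive a g z) U := hu.sub hΓ
  obtain ⟨Cζ, hCζ⟩ := hζc.exists_bound_of_continuous hζ.continuous
  have hζv : IntegrableOn (fun z => (u z - primitive a g z) * ζ z.1) U :=
    hv.mul_of_continuous_bounded (hζ.continuous.comp continuous_fst) fun z => hCζ z.1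
  -- As `ζ` has integral 1, this average must be the value of `u - primitive a g` on a row where
  -- that difference is constant.
  set C : ℝ → ℝ := fun y => ∫ x in Ioo a b, (u (x, y) - primitive a g (x, y)) * ζ x with hCdef
  have hCi : IntegrableOn C (Ioo c d) := by
    have h := hζv
    rw [hU, IntegrableOn, restrict_prod] at h
    exact h.integral_prod_right
  have hCU : IntegrableOn (fun z : ℝ × ℝ => C z.2) U := by
    rw [hU, IntegrableOn, restrict_prod]
    exact hCi.comp_snd _
  refine ⟨C, ?_⟩
  have key : ∀ η : ℝ × ℝ → ℝ, ContDiff ℝ ∞ η → HasCompactSupport η → tsupport η ⊆ U →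
      ∫ z, η z • U.indicator (fun z => u z - primitive a g z - C z.2) z = 0 := by
    intro η hη hηc hηs
    have hk1 : IsCompact (Prod.fst '' tsupport η) := hηc.isCompact.image continuous_fst
    have hk2 : IsCompact (Prod.snd '' tsupport η) := hηc.isCompact.image continuous_snd
    have hz1 : ∀ x, x ∉ Prod.fst '' tsupport η → ∀ y, η (x, y) = 0 := fun x hx y =>
      image_eq_zero_of_notMem_tsupport fun h => hx ⟨_, h, rfl⟩
    have hz2 : ∀ y, y ∉ Prod.snd '' tsupport η → ∀ x, η (x, y) = 0 := fun y hy x =>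
      image_eq_zero_of_notMem_tsupport fun h => hy ⟨_, h, rfl⟩
    have hk1s : Prod.fst '' tsupport η ⊆ Ioo a b := by
      rintro _ ⟨z, hz, rfl⟩; exact (hηs hz).1
    have hk2s : Prod.snd '' tsupport η ⊆ Ioo c d := by
      rintro _ ⟨z, hz, rfl⟩; exact (hηs hz).2
    have hηa : ∀ s ≤ a, ∀ y, η (s, y) = 0 := fun s hs y => hz1 s (fun h => by
      linarith [(hk1s h).1]) y
    set h : ℝ → ℝ := fun y => ∫ s in a..b, η (s, y) with hh
    have hhsm : ContDiff ℝ ∞ h :=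
      (contDiff_primitive hη hηc hηa).comp (contDiff_const.prodMk contDiff_id)
    have hhz : ∀ y, y ∉ Prod.snd '' tsupport η → h y = 0 := fun y hy => by
      simp [hh, hz2 y hy]
    have hhc : HasCompactSupport h := HasCompactSupport.intro hk2 hhz
    -- Subtracting `ζ` times the row integral gives `κ` mean zero on every row. Hence `κ` is the
    -- derivative in the first variable of a test function, and the weak equation applies to it.
    set κ : ℝ × ℝ → ℝ := fun z => η z - ζ z.1 * h z.2 with hκdef
    have hζh : ContDiff ℝ ∞ fun z : ℝ × ℝ => ζ z.1 * h z.2 :=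
      (hζ.comp contDiff_fst).mul (hhsm.comp contDiff_snd)
    have hκ : ContDiff ℝ ∞ κ := hη.sub hζh
    have hKK : IsCompact ((Prod.fst '' tsupport η ∪ tsupport ζ) ×ˢ (Prod.snd '' tsupport η)) :=
      (hk1.union hζc.isCompact).prod hk2
    have hsupp : Function.support κ ⊆
        (Prod.fst '' tsupport η ∪ tsupport ζ) ×ˢ (Prod.snd '' tsupport η) := by
      intro z hz
      by_contra hcon
      refine hz ?_
      have hz' : κ z = η (z.1, z.2) - ζ z.1 * h z.2 := rfl
      rw [mem_prod, not_and_or] at hcon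
      rcases hcon with hcon | hcon
      · rw [mem_union, not_or] at hcon
        rw [hz', hz1 _ hcon.1, image_eq_zero_of_notMem_tsupport hcon.2]; simp
      · rw [hz', hz2 _ hcon, hhz _ hcon]; simp
    have hκc : HasCompactSupport κ := HasCompactSupport.of_support_subset_isCompact hKK hsupp
    have hκs : tsupport κ ⊆ U := (closure_minimal hsupp hKK.isClosed).trans
      (prod_mono (union_subset hk1s hζs) hk2s)
    have hκ0 : ∀ y, ∫ s in a..b, κ (s, y) = 0 := by
      intro y
      have i1 : IntervalIntegrable (fun s => η (s, y)) volume a b :=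
        (hη.continuous.comp (by fun_prop)).intervalIntegrable _ _
      have i2 : IntervalIntegrable (fun s => ζ s * h y) volume a b :=
        (hζ.continuous.mul continuous_const).intervalIntegrable _ _
      simp only [hκdef]
      rw [intervalIntegral.integral_sub i1 i2, intervalIntegral.integral_mul_const, hζ1, one_mul]
      exact sub_self _
    obtain ⟨hT, hTc, hTs⟩ := primitive_facts hκ hκc hκs hκ0
    have hweak := hw _ hT hTc hTs
    simp only [fderiv_primitive hκ.continuous (hT.differentiable (by simp))] at hweak
    obtain ⟨Cκ, hCκ⟩ := hκc.exists_bound_of_continuous hκ.continuous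
    obtain ⟨CT, hCT⟩ := hTc.exists_bound_of_continuous hT.continuous
    obtain ⟨Cη, hCη⟩ := hηc.exists_bound_of_continuous hη.continuous
    obtain ⟨Ch, hCh⟩ := hhc.exists_bound_of_continuous hhsm.continuous
    have hgT : ∫ z in U, g z * primitive a κ z = - ∫ z in U, primitive a g z * κ z := by
      rw [hU, setIntegral_rect (hg.mul_of_continuous_bounded hT.continuous hCT),
        setIntegral_rect (hΓ.mul_of_continuous_bounded hκ.continuous hCκ), ← integral_neg]
      refine integral_congr_ae ?_
      have hg' := hg
      rw [hU, IntegrableOn, restrict_prod] at hg'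
      filter_upwards [hg'.prod_left_ae] with y hy
      exact integral_mul_primitive hab.le hy (hκ.continuous.comp (by fun_prop)) (hκ0 y)
    have h1 : ∫ z in U, (u z - primitive a g z) * κ z = 0 := by
      simp only [sub_mul]
      rw [integral_sub (hu.mul_of_continuous_bounded hκ.continuous hCκ)
        (hΓ.mul_of_continuous_bounded hκ.continuous hCκ), hweak, hgT]
      ring
    have i1 : IntegrableOn (fun z => (u z - primitive a g z) * η z) U :=
      hv.mul_of_continuous_bounded hη.continuous hCη
    have i2 : IntegrableOn (fun z => (u z - primitive a g z) * ζ z.1 * h z.2) U :=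
      hζv.mul_of_continuous_bounded (hhsm.continuous.comp continuous_snd) fun z => hCh z.2
    have i3 : IntegrableOn (fun z => C z.2 * η z) U :=
      hCU.mul_of_continuous_bounded hη.continuous hCη
    -- By Fubini the correction `ζ h`, tested against the difference, produces exactly the average
    -- `C` tested against `η`.
    have h2 : ∫ z in U, (u z - primitive a g z) * ζ z.1 * h z.2 = ∫ z in U, C z.2 * η z := by
      rw [hU, setIntegral_rect i2, setIntegral_rect i3]
      congr 1
      funext y
      change ∫ x in Ioo a b, (u (x, y) - primitive a g (x, y)) * ζ x * h y
        = ∫ x in Ioo a b, C y * η (x, y)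
      have e : h y = ∫ x in Ioo a b, η (x, y) := by
        rw [← integral_Ioc_eq_integral_Ioo, ← intervalIntegral.integral_of_le hab.le]
      rw [integral_mul_const, integral_const_mul, e]
    have h3 : ∫ z in U, (u z - primitive a g z) * κ z
        = (∫ z in U, (u z - primitive a g z) * η z) - ∫ z in U, C z.2 * η z := by
      rw [← h2, ← integral_sub i1 i2]
      congr 1
      funext z
      simp only [hκdef]; ring
    have e : ∀ z, η z • U.indicator (fun z => u z - primitive a g z - C z.2) z
        = U.indicator (fun z => (u z - primitive a g z) * η z - C z.2 * η z) z := by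
      intro z
      by_cases hz : z ∈ U
      · simp only [indicator_of_mem hz, smul_eq_mul]; ring
      · simp only [indicator_of_notMem hz, smul_zero]
    simp only [e]
    rw [integral_indicator hUo.measurableSet, integral_sub i1 i3, ← h3, h1]
  have hloc : LocallyIntegrableOn (U.indicator fun z => u z - primitive a g z - C z.2) U :=
    ((integrable_indicator_iff hUo.measurableSet).2 (hv.sub hCU)).locallyIntegrable.locallyIntegrableOn _
  have hae := hUo.ae_eq_zero_of_integral_contDiff_smul_eq_zero hloc key
  rw [ae_restrict_iff' hUo.measurableSet]
  filter_upwards [hae] with z hz hzU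
  have := hz hzU
  rw [indicator_of_mem hzU] at this
  linarith

lemma setIntegral_eq_of_support_subset {U V : Set (ℝ × ℝ)} (hV : MeasurableSet V) (hUV : U ⊆ V)
    {F : ℝ × ℝ → ℝ} (hF : Function.support F ⊆ U) : ∫ z in V, F z = ∫ z in U, F z :=
  setIntegral_eq_of_subset_of_forall_sdiff_eq_zero hV hUV fun z hz => by
    by_contra h
    exact hz.2 (hF h)

lemma support_fderiv_apply_subset {φ : ℝ × ℝ → ℝ} (v : ℝ × ℝ) :
    Function.support (fun z => fderiv ℝ φ z v) ⊆ tsupport φ := by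
  intro z hz
  refine support_fderiv_subset ℝ fun h => hz ?_
  simp only [h]; rfl

lemma exists_exhaustion {x₀ : ℝ} (hx : x₀ ∈ Ioo a b) : ∃ α β : ℕ → ℝ, Antitone α ∧ Monotone β ∧
    (∀ n, α n ∈ Ioo a x₀ ∧ β n ∈ Ioo x₀ b) ∧
    ∀ x ∈ Ioo a b, ∃ N, ∀ n ≥ N, x ∈ Ioo (α n) (β n) := by
  obtain ⟨α, hα, hα', hαt⟩ := exists_seq_strictAnti_tendsto' hx.1
  obtain ⟨β, hβ, hβ', hβt⟩ := exists_seq_strictMono_tendsto' hx.2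
  refine ⟨α, β, hα.antitone, hβ.monotone, fun n => ⟨hα' n, hβ' n⟩, fun x hxm => ?_⟩
  exact eventually_atTop.1 ((hαt.eventually_lt_const hxm.1).and (hβt.eventually_const_lt hxm.2))

/-- A locally integrable function on a rectangle with a locally integrable weak derivative in the
first variable is absolutely continuous on almost every line parallel to the first axis. -/
theorem ae_exists_eq_const_add_integral {x₀ : ℝ} (hx₀ : x₀ ∈ Ioo a b) {u g : ℝ × ℝ → ℝ}
    (hu : LocallyIntegrableOn u (Ioo a b ×ˢ Ioo c d))
    (hg : LocallyIntegrableOn g (Ioo a b ×ˢ Ioo c d))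
    (hw : ∀ φ : ℝ × ℝ → ℝ, ContDiff ℝ ∞ φ → HasCompactSupport φ →
      tsupport φ ⊆ Ioo a b ×ˢ Ioo c d →
      ∫ z in Ioo a b ×ˢ Ioo c d, u z * fderiv ℝ φ z eR
        = - ∫ z in Ioo a b ×ˢ Ioo c d, g z * φ z) :
    ∀ᵐ y ∂volume.restrict (Ioo c d),
      (∀ x ∈ Ioo a b, ∀ x' ∈ Ioo a b, IntervalIntegrable (fun t => g (t, y)) volume x x') ∧
      ∃ C, ∀ᵐ x ∂volume.restrict (Ioo a b), u (x, y) = C + ∫ t in x₀..x, g (t, y) := by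
  rcases (Ioo c d).eq_empty_or_nonempty with hcd | ⟨y₀, hy₀⟩
  · simp [hcd]
  obtain ⟨α, β, hα, hβ, hαβ, hex⟩ := exists_exhaustion hx₀
  obtain ⟨γ, δ, hγ, hδ, hγδ, hey⟩ := exists_exhaustion hy₀
  have hin : ∀ n, Icc (α n) (β n) ×ˢ Icc (γ n) (δ n) ⊆ Ioo a b ×ˢ Ioo c d := fun n =>
    prod_mono (fun x hx => ⟨(hαβ n).1.1.trans_le hx.1, hx.2.trans_lt (hαβ n).2.2⟩)
      (fun x hx => ⟨(hγδ n).1.1.trans_le hx.1, hx.2.trans_lt (hγδ n).2.2⟩)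
  have hin' : ∀ n, Ioo (α n) (β n) ×ˢ Ioo (γ n) (δ n) ⊆ Icc (α n) (β n) ×ˢ Icc (γ n) (δ n) :=
    fun n => prod_mono Ioo_subset_Icc_self Ioo_subset_Icc_self
  have hint : ∀ {F : ℝ × ℝ → ℝ}, LocallyIntegrableOn F (Ioo a b ×ˢ Ioo c d) → ∀ n,
      IntegrableOn F (Ioo (α n) (β n) ×ˢ Ioo (γ n) (δ n)) := fun hF n =>
    (hF.integrableOn_compact_subset (hin n) (isCompact_Icc.prod isCompact_Icc)).mono_set (hin' n)
  have hstep : ∀ n, ∀ᵐ y, y ∈ Ioo (γ n) (δ n) →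
      IntegrableOn (fun t => g (t, y)) (Ioo (α n) (β n)) ∧
      ∃ C, ∀ᵐ x ∂volume.restrict (Ioo (α n) (β n)), u (x, y) = C + ∫ t in x₀..x, g (t, y) := by
    intro n
    have hab : α n < β n := (hαβ n).1.2.trans (hαβ n).2.1
    obtain ⟨C, hC⟩ := exists_ae_eq_add_primitive hab (hint hu n) (hint hg n) (by
      intro φ h1 h2 h3
      have hsub := (hin' n).trans (hin n)
      have hm : MeasurableSet (Ioo a b ×ˢ Ioo c d) := measurableSet_Ioo.prod measurableSet_Ioo
      rw [← setIntegral_eq_of_support_subset hm hsub, ← setIntegral_eq_of_support_subset hm hsub]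
      · exact hw φ h1 h2 (h3.trans hsub)
      · exact (Function.support_mul_subset_right _ _).trans ((subset_tsupport φ).trans h3)
      · exact (Function.support_mul_subset_right _ _).trans
          ((support_fderiv_apply_subset eR).trans h3))
    have hgi := hint hg n
    rw [IntegrableOn, restrict_prod] at hgi
    rw [← ae_restrict_iff' measurableSet_Ioo]
    filter_upwards [hgi.prod_left_ae, ae_snd_of_ae hC] with y hy1 hy2
    -- The additional integral moves the base point from `α n`, which varies with the rectangle, to
    -- `x₀`.
    refine ⟨hy1, C y + ∫ t in (α n)..x₀, g (t, y), ?_⟩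
    filter_upwards [hy2, ae_restrict_mem measurableSet_Ioo] with x hx hxm
    have hi : IntervalIntegrable (fun t => g (t, y)) volume (α n) (β n) := by
      rw [intervalIntegrable_iff_integrableOn_Ioo_of_le hab.le]; exact hy1
    rw [hx, add_assoc, intervalIntegral.integral_add_adjacent_intervals]
    · rfl
    · exact hi.mono_set (uIcc_subset_uIcc left_mem_uIcc
        (by rw [uIcc_of_le hab.le]; exact ⟨(hαβ n).1.2.le, (hαβ n).2.1.le⟩))
    · refine hi.mono_set (uIcc_subset_uIcc ?_ ?_) <;> rw [uIcc_of_le hab.le]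
      · exact ⟨(hαβ n).1.2.le, (hαβ n).2.1.le⟩
      · exact Ioo_subset_Icc_self hxm
  rw [ae_restrict_iff' measurableSet_Ioo]
  filter_upwards [ae_all_iff.2 hstep] with y hy hyU
  obtain ⟨N, hN⟩ := hey y hyU
  constructor
  · intro x hx x' hx'
    obtain ⟨N₁, h₁⟩ := hex x hx
    obtain ⟨N₂, h₂⟩ := hex x' hx'
    set n := max N (max N₁ N₂)
    have hab : α n < β n := (hαβ n).1.2.trans (hαβ n).2.1
    have hi : IntervalIntegrable (fun t => g (t, y)) volume (α n) (β n) := by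
      rw [intervalIntegrable_iff_integrableOn_Ioo_of_le hab.le]
      exact (hy n (hN n (le_max_left _ _))).1
    refine hi.mono_set (uIcc_subset_uIcc ?_ ?_) <;> rw [uIcc_of_le hab.le]
    · exact Ioo_subset_Icc_self (h₁ n (by simp [n]))
    · exact Ioo_subset_Icc_self (h₂ n (by simp [n]))
  -- For `n < N` the row `y` may miss the rectangle, and an arbitrary constant is taken.
  · have hc : ∀ n, ∃ C, N ≤ n → ∀ᵐ x ∂volume.restrict (Ioo (α n) (β n)),
        u (x, y) = C + ∫ t in x₀..x, g (t, y) := by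
      intro n
      by_cases hn : N ≤ n
      · obtain ⟨C, hC⟩ := (hy n (hN n hn)).2
        exact ⟨C, fun _ => hC⟩
      · exact ⟨0, fun h => absurd h hn⟩
    choose C hC using hc
    -- Both formulas hold almost everywhere on an interval of positive length, hence at a common
    -- point.
    have hCeq : ∀ n, N ≤ n → C n = C N := by
      intro n hn
      have hsub : Ioo (α N) (β N) ⊆ Ioo (α n) (β n) := Ioo_subset_Ioo (hα hn) (hβ hn)
      have h1 := ae_restrict_of_ae_restrict_of_subset hsub (hC n hn)
      have hne : (volume.restrict (Ioo (α N) (β N))) ≠ 0 := by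
        rw [Ne, Measure.restrict_eq_zero, Real.volume_Ioo, ENNReal.ofReal_eq_zero, not_le, sub_pos]
        exact (hαβ N).1.2.trans (hαβ N).2.1
      have : NeBot (ae (volume.restrict (Ioo (α N) (β N)))) := ae_neBot.2 hne
      obtain ⟨x, hx1, hx2⟩ := (h1.and (hC N le_rfl)).exists
      linarith
    refine ⟨C N, ?_⟩
    rw [ae_restrict_iff' measurableSet_Ioo]
    have hall : ∀ n, ∀ᵐ x, N ≤ n → x ∈ Ioo (α n) (β n) → u (x, y) = C N + ∫ t in x₀..x, g (t, y) := by
      intro n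
      by_cases hn : N ≤ n
      · have := (ae_restrict_iff' measurableSet_Ioo).1 (hC n hn)
        rw [hCeq n hn] at this
        filter_upwards [this] with x hx _ hxm using hx hxm
      · exact .of_forall fun x h => absurd h hn
    filter_upwards [ae_all_iff.2 hall] with x hx hxm
    obtain ⟨N₁, h₁⟩ := hex x hxm
    exact hx (max N N₁) (le_max_left _ _) (h₁ _ (le_max_right _ _))

end line

/-! ### Uniqueness of weak derivatives and traces -/

lemma isOpen_D : IsOpen D := isOpen_Ioo.prod isOpen_Ioo

lemma measurableSet_D : MeasurableSet D := isOpen_D.measurableSet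

lemma isWeakDeriv_weakDeriv {v : ℝ × ℝ} {ψ : ℝ × ℝ → ℝ} (h : ∃ g, IsWeakDeriv v ψ g) :
    IsWeakDeriv v ψ (weakDeriv v ψ) := by
  rw [weakDeriv, dif_pos h]
  exact h.choose_spec

lemma integrableOn_mul_of_isCompact {F φ : ℝ × ℝ → ℝ} {S A K : Set (ℝ × ℝ)}
    (hF : LocallyIntegrableOn F S) (hK : IsCompact K) (hKS : K ⊆ S) (hA : MeasurableSet A)
    (hφ : Continuous φ) (hz : ∀ z ∈ A \ K, φ z = 0) : IntegrableOn (fun z => F z * φ z) A := by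
  obtain ⟨C, hC⟩ := hK.exists_bound_of_continuousOn hφ.continuousOn
  have h1 : IntegrableOn (fun z => F z * φ z) K := by
    refine Integrable.mul_bdd (c := C) (hF.integrableOn_compact_subset hKS hK)
      hφ.aestronglyMeasurable ?_
    filter_upwards [ae_restrict_mem hK.measurableSet] with z hz using hC z hz
  exact h1.of_forall_sdiff_eq_zero hA fun z hz' => by rw [hz z hz', mul_zero]

lemma continuous_fderiv_apply {φ : ℝ × ℝ → ℝ} (hφ : ContDiff ℝ ∞ φ) (v : ℝ × ℝ) :
    Continuous fun z => fderiv ℝ φ z v :=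
  (hφ.continuous_fderiv (by simp)).clm_apply continuous_const

lemma fderiv_apply_eq_zero {φ : ℝ × ℝ → ℝ} {z : ℝ × ℝ} (hz : z ∉ tsupport φ) (v : ℝ × ℝ) :
    fderiv ℝ φ z v = 0 := by
  by_contra h
  exact hz (support_fderiv_apply_subset v h)

/-- The fundamental lemma of the calculus of variations. `weakDeriv` is a choice, so all
computations with it pass through this almost everywhere equality. -/
lemma IsWeakDeriv.ae_eq {v : ℝ × ℝ} {ψ ψ' g g' : ℝ × ℝ → ℝ} (h : IsWeakDeriv v ψ g)
    (h' : IsWeakDeriv v ψ' g') (hψ : ψ =ᵐ[volume.restrict D] ψ') :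
    g =ᵐ[volume.restrict D] g' := by
  have key := isOpen_D.ae_eq_zero_of_integral_contDiff_smul_eq_zero
    (f := D.indicator fun z => g z - g' z) (μ := volume) ?_ ?_
  · rw [EventuallyEq, ae_restrict_iff' measurableSet_D]
    filter_upwards [key] with z hz hzD
    have := hz hzD
    rw [indicator_of_mem hzD] at this
    linarith
  · refine (locallyIntegrableOn_iff isOpen_D.isLocallyClosed).2 fun K hK hKc => ?_
    refine ((h.2.1.integrableOn_compact_subset hK hKc).sub
      (h'.2.1.integrableOn_compact_subset hK hKc)).congr_fun ?_ hKc.measurableSet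
    intro z hz
    rw [indicator_of_mem (hK hz)]; rfl
  · intro φ hφ hφc hφs
    have hz : ∀ z ∈ D \ tsupport φ, φ z = 0 := fun z hz => image_eq_zero_of_notMem_tsupport hz.2
    have i1 := integrableOn_mul_of_isCompact h.2.1 hφc.isCompact hφs measurableSet_D
      hφ.continuous hz
    have i2 := integrableOn_mul_of_isCompact h'.2.1 hφc.isCompact hφs measurableSet_D
      hφ.continuous hz
    have e : ∀ z, φ z • D.indicator (fun z => g z - g' z) z
        = D.indicator (fun z => g z * φ z - g' z * φ z) z := by
      intro z
      by_cases hz : z ∈ D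
      · simp only [indicator_of_mem hz, smul_eq_mul]; ring
      · simp only [indicator_of_notMem hz, smul_zero]
    simp only [e]
    rw [integral_indicator measurableSet_D, integral_sub i1 i2]
    have e1 := h.2.2 φ hφ hφc hφs
    have e2 := h'.2.2 φ hφ hφc hφs
    have e3 : ∫ z in D, ψ z * fderiv ℝ φ z v = ∫ z in D, ψ' z * fderiv ℝ φ z v := by
      refine integral_congr_ae ?_
      filter_upwards [hψ] with z hz
      rw [hz]
    linarith

lemma weakDeriv_ae_eq {v : ℝ × ℝ} {ψ g : ℝ × ℝ → ℝ} (h : IsWeakDeriv v ψ g) :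
    weakDeriv v ψ =ᵐ[volume.restrict D] g :=
  (isWeakDeriv_weakDeriv ⟨g, h⟩).ae_eq h (.refl _ _)

lemma hasTrace_trace {ψ : ℝ × ℝ → ℝ} {f : ℝ → ℝ} (h : HasTrace ψ f) : HasTrace ψ (trace ψ) := by
  have hex : ∃ f, HasTrace ψ f := ⟨f, h⟩
  rw [trace, dif_pos hex]
  exact hex.choose_spec

lemma HasTrace.ae_eq {ψ : ℝ × ℝ → ℝ} {f g : ℝ → ℝ} (hf : HasTrace ψ f) (hg : HasTrace ψ g) :
    f =ᵐ[volume.restrict (Ioo 0 Real.pi)] g := by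
  -- A cutoff in `r` around 1, supported in `[1/2, 3/2]`: it turns a test function `η(θ)` into the
  -- admissible `χ(r) η(θ)` without changing its values on `r = 1`.
  let χ : ContDiffBump (1 : ℝ) := ⟨1 / 4, 1 / 2, by norm_num, by norm_num⟩
  have hχ1 : χ 1 = 1 := χ.one_of_mem_closedBall (by simp [χ])
  have hχs : tsupport χ ⊆ Ioi 0 := by
    rw [χ.tsupport_eq, Real.closedBall_eq_Icc]
    intro x hx
    simp only [χ, mem_Icc] at hx
    simp only [mem_Ioi]; linarith
  have key := (isOpen_Ioo (a := 0) (b := Real.pi)).ae_eq_zero_of_integral_contDiff_smul_eq_zero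
    (f := (Ioo 0 Real.pi).indicator fun z => f z - g z) (μ := volume) ?_ ?_
  · rw [EventuallyEq, ae_restrict_iff' measurableSet_Ioo]
    filter_upwards [key] with z hz hzD
    have := hz hzD
    rw [indicator_of_mem hzD] at this
    linarith
  · refine (locallyIntegrableOn_iff isOpen_Ioo.isLocallyClosed).2 fun K hK hKc => ?_
    refine ((hf.1.integrableOn_compact_subset hK hKc).sub
      (hg.1.integrableOn_compact_subset hK hKc)).congr_fun ?_ hKc.measurableSet
    intro z hz
    rw [indicator_of_mem (hK hz)]; rfl
  · intro η hη hηc hηs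
    have hcont : ContDiff ℝ ∞ fun z : ℝ × ℝ => χ z.1 * η z.2 :=
      (χ.contDiff.comp contDiff_fst).mul (hη.comp contDiff_snd)
    have hK : IsCompact (tsupport χ ×ˢ tsupport η) := χ.hasCompactSupport.isCompact.prod hηc.isCompact
    have hsupp : Function.support (fun z : ℝ × ℝ => χ z.1 * η z.2) ⊆ tsupport χ ×ˢ tsupport η :=
      fun z hz => ⟨subset_tsupport _ (left_ne_zero_of_mul hz),
        subset_tsupport _ (right_ne_zero_of_mul hz)⟩
    have hφc := HasCompactSupport.of_support_subset_isCompact hK hsupp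
    have hφs : tsupport (fun z : ℝ × ℝ => χ z.1 * η z.2) ⊆ Ioi 0 ×ˢ Ioo 0 Real.pi :=
      (closure_minimal hsupp hK.isClosed).trans (prod_mono hχs hηs)
    have e1 := hf.2.2.2 _ hcont hφc hφs
    have e2 := hg.2.2.2 _ hcont hφc hφs
    simp only [hχ1, one_mul] at e1 e2
    have hint : ∀ {f : ℝ → ℝ}, LocallyIntegrableOn f (Ioo 0 Real.pi) →
        IntegrableOn (fun z => f z * η z) (Ioo 0 Real.pi) := by
      intro f hf
      obtain ⟨C, hC⟩ := hηc.exists_bound_of_continuous hη.continuous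
      have h1 : IntegrableOn (fun z => f z * η z) (tsupport η) :=
        Integrable.mul_bdd (c := C) (hf.integrableOn_compact_subset hηs hηc.isCompact)
          hη.continuous.aestronglyMeasurable (.of_forall hC)
      exact h1.of_forall_sdiff_eq_zero measurableSet_Ioo fun z hz => by
        rw [image_eq_zero_of_notMem_tsupport hz.2, mul_zero]
    have e : ∀ z, η z • (Ioo 0 Real.pi).indicator (fun z => f z - g z) z
        = (Ioo 0 Real.pi).indicator (fun z => f z * η z - g z * η z) z := by
      intro z
      by_cases hz : z ∈ Ioo 0 Real.pi
      · simp only [indicator_of_mem hz, smul_eq_mul]; ring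
      · simp only [indicator_of_notMem hz, smul_zero]
    simp only [e]
    rw [integral_indicator measurableSet_Ioo, integral_sub (hint hf.1) (hint hg.1)]
    linarith

lemma trace_ae_eq {ψ : ℝ × ℝ → ℝ} {f : ℝ → ℝ} (h : HasTrace ψ f) :
    trace ψ =ᵐ[volume.restrict (Ioo 0 Real.pi)] f :=
  (hasTrace_trace h).ae_eq h

lemma hasDerivAt_fst_slice {φ : ℝ × ℝ → ℝ} (hφ : Differentiable ℝ φ) (x y : ℝ) :
    HasDerivAt (fun s => φ (s, y)) (fderiv ℝ φ (x, y) eR) x :=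
  HasFDerivAt.comp_hasDerivAt (f := fun s => (s, y)) x (hφ (x, y)).hasFDerivAt
    ((hasDerivAt_id' x).prodMk (hasDerivAt_const x y))

lemma hasDerivAt_snd_slice {φ : ℝ × ℝ → ℝ} (hφ : Differentiable ℝ φ) (x y : ℝ) :
    HasDerivAt (fun s => φ (x, s)) (fderiv ℝ φ (x, y) eTheta) y :=
  HasFDerivAt.comp_hasDerivAt (f := fun s => (x, s)) y (hφ (x, y)).hasFDerivAt
    ((hasDerivAt_const y x).prodMk (hasDerivAt_id' y))

lemma integrableOn_comp_snd_of_isCompact {f : ℝ → ℝ} {t : Set ℝ} (hf : LocallyIntegrableOn f t)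
    {K : Set (ℝ × ℝ)} (hK : IsCompact K) (h : ∀ z ∈ K, z.2 ∈ t) :
    IntegrableOn (fun z : ℝ × ℝ => f z.2) K := by
  have hk1 : IsCompact (Prod.fst '' K) := hK.image continuous_fst
  have hk2 : IsCompact (Prod.snd '' K) := hK.image continuous_snd
  have h1 : IntegrableOn f (Prod.snd '' K) := hf.integrableOn_compact_subset (by
    rintro _ ⟨z, hz, rfl⟩; exact h z hz) hk2
  have : IsFiniteMeasure (volume.restrict (Prod.fst '' K)) :=
    isFiniteMeasure_restrict.2 hk1.measure_lt_top.ne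
  have h2 : IntegrableOn (fun z : ℝ × ℝ => f z.2) ((Prod.fst '' K) ×ˢ (Prod.snd '' K)) := by
    rw [IntegrableOn, restrict_prod]
    exact Integrable.comp_snd h1 _
  exact h2.mono_set fun z hz => ⟨⟨z, hz, rfl⟩, ⟨z, hz, rfl⟩⟩

/-! ### Restriction to rays and half circles -/

/-- A function with trace `f` is, on almost every ray, absolutely continuous with boundary
value `f`. -/
theorem HasTrace.ae_eq_add_integral {ψ : ℝ × ℝ → ℝ} {f : ℝ → ℝ} (h : HasTrace ψ f) :
    ∀ᵐ θ ∂volume.restrict (Ioo 0 Real.pi), ∀ r ∈ Ioo (0 : ℝ) 1,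
      IntervalIntegrable (fun t => weakDeriv eR ψ (t, θ)) volume r 1 ∧
      ∀ᵐ r ∂volume.restrict (Ioo (0 : ℝ) 1),
        ψ (r, θ) = f θ - ∫ t in r..1, weakDeriv eR ψ (t, θ) := by
  classical
  obtain ⟨hf, hψ, hp, htr⟩ := h
  set p := weakDeriv eR ψ
  set V : Set (ℝ × ℝ) := Ioo 0 2 ×ˢ Ioo 0 Real.pi with hV
  have hVo : IsOpen V := isOpen_Ioo.prod isOpen_Ioo
  set A : Set (ℝ × ℝ) := {z | z.1 < 1} with hA
  have hAm : MeasurableSet A := measurableSet_lt measurable_fst measurable_const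
  set E : Set (ℝ × ℝ) := Ico 1 2 ×ˢ Ioo 0 Real.pi with hE
  have hEm : MeasurableSet E := measurableSet_Ico.prod measurableSet_Ioo
  have hVDE : V = D ∪ E := by
    ext z
    simp only [hV, D, hE, mem_prod, mem_union, mem_Ioo, mem_Ico]
    constructor
    · rintro ⟨⟨h1, h2⟩, h3⟩
      rcases lt_or_ge z.1 1 with h | h
      · exact Or.inl ⟨⟨h1, h⟩, h3⟩
      · exact Or.inr ⟨⟨h, h2⟩, h3⟩
    · rintro (⟨⟨h1, h2⟩, h3⟩ | ⟨⟨h1, h2⟩, h3⟩)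
      · exact ⟨⟨h1, by linarith⟩, h3⟩
      · exact ⟨⟨by linarith, h2⟩, h3⟩
  have hdisj : Disjoint D E := by
    rw [Set.disjoint_left]
    intro z h1 h2
    exact absurd h1.1.2 (not_lt.2 h2.1.1)
  have hDA : D ⊆ A := fun z hz => hz.1.2
  have hEA : ∀ z ∈ E, z ∉ A := fun z hz => not_lt.2 hz.1.1
  -- Extend `ψ` beyond `r = 1` by its trace, constantly in `r`. The trace identity says precisely
  -- that this creates no jump: the extension has weak derivative `∂_r ψ` continued by zero.
  set u : ℝ × ℝ → ℝ := A.piecewise ψ fun z => f z.2 with hu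
  set g : ℝ × ℝ → ℝ := A.piecewise p fun _ => 0 with hg
  have hloc : ∀ (F : ℝ × ℝ → ℝ) (G : ℝ → ℝ),
      LocallyIntegrableOn F (Ioc 0 1 ×ˢ Ioo 0 Real.pi) → LocallyIntegrableOn G (Ioo 0 Real.pi) →
      LocallyIntegrableOn (A.piecewise F fun z => G z.2) V := by
    intro F G hF hG
    refine (locallyIntegrableOn_iff hVo.isLocallyClosed).2 fun K hK hKc => ?_
    have hcl : IsClosed {z : ℝ × ℝ | z.1 ≤ 1} := isClosed_le continuous_fst continuous_const
    have h1 : IntegrableOn F (K ∩ {z | z.1 ≤ 1}) :=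
      hF.integrableOn_compact_subset (fun z hz => ⟨⟨(hK hz.1).1.1, hz.2⟩, (hK hz.1).2⟩)
        (hKc.inter_right hcl)
    have h2 : IntegrableOn (fun z : ℝ × ℝ => G z.2) K :=
      integrableOn_comp_snd_of_isCompact hG hKc fun z hz => (hK hz).2
    rw [IntegrableOn, ← integrableOn_univ]
    rw [← union_compl_self A]
    refine IntegrableOn.union ?_ ?_
    · rw [IntegrableOn, Measure.restrict_restrict hAm]
      refine IntegrableOn.congr_fun (h1.mono_set ?_) (fun z hz => ?_)
        (hAm.inter hKc.measurableSet)
      · exact fun z hz => ⟨hz.2, (show z.1 < 1 from hz.1).le⟩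
      · exact (piecewise_eq_of_mem _ _ _ hz.1).symm
    · rw [IntegrableOn, Measure.restrict_restrict hAm.compl]
      refine IntegrableOn.congr_fun (h2.mono_set inter_subset_right) (fun z hz => ?_)
        (hAm.compl.inter hKc.measurableSet)
      exact (piecewise_eq_of_notMem A F (fun z => G z.2) hz.1).symm
  have huloc : LocallyIntegrableOn u V := hloc ψ f hψ hf
  have hgloc : LocallyIntegrableOn g V := hloc p (fun _ => 0) hp
    ((locallyIntegrable_const (0 : ℝ)).locallyIntegrableOn _)
  have hweak : ∀ φ : ℝ × ℝ → ℝ, ContDiff ℝ ∞ φ → HasCompactSupport φ → tsupport φ ⊆ V →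
      ∫ z in V, u z * fderiv ℝ φ z eR = - ∫ z in V, g z * φ z := by
    intro φ hφ hφc hφs
    have hcf := continuous_fderiv_apply hφ eR
    have hVm := hVo.measurableSet
    have hDV : D ⊆ V := hVDE ▸ subset_union_left
    have hEV : E ⊆ V := hVDE ▸ subset_union_right
    have iu : IntegrableOn (fun z => u z * fderiv ℝ φ z eR) V :=
      integrableOn_mul_of_isCompact huloc hφc.isCompact hφs hVm hcf
        fun z hz => fderiv_apply_eq_zero hz.2 _
    have ig : IntegrableOn (fun z => g z * φ z) V :=
      integrableOn_mul_of_isCompact hgloc hφc.isCompact hφs hVm hφ.continuous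
        fun z hz => image_eq_zero_of_notMem_tsupport hz.2
    have huD : EqOn (fun z => u z * fderiv ℝ φ z eR) (fun z => ψ z * fderiv ℝ φ z eR) D :=
      fun z hz => by simp only [hu, piecewise_eq_of_mem _ _ _ (hDA hz)]
    have hgD : EqOn (fun z => g z * φ z) (fun z => p z * φ z) D :=
      fun z hz => by simp only [hg, piecewise_eq_of_mem _ _ _ (hDA hz)]
    have huE : EqOn (fun z => u z * fderiv ℝ φ z eR) (fun z => f z.2 * fderiv ℝ φ z eR) E :=
      fun z hz => by simp only [hu, piecewise_eq_of_notMem _ _ _ (hEA z hz)]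
    have hgE : EqOn (fun z => g z * φ z) (fun _ => 0) E :=
      fun z hz => by simp only [hg, piecewise_eq_of_notMem _ _ _ (hEA z hz), zero_mul]
    have t := htr φ hφ hφc (hφs.trans (prod_mono (fun x hx => hx.1) subset_rfl))
    have iD1 : IntegrableOn (fun z => ψ z * fderiv ℝ φ z eR) D :=
      (iu.mono_set hDV).congr_fun huD measurableSet_D
    have iD2 : IntegrableOn (fun z => p z * φ z) D :=
      (ig.mono_set hDV).congr_fun hgD measurableSet_D
    have iE : IntegrableOn (fun z => f z.2 * fderiv ℝ φ z eR) E :=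
      (iu.mono_set hEV).congr_fun huE hEm
    rw [integral_add iD1 iD2] at t
    have hEint : ∫ z in E, f z.2 * fderiv ℝ φ z eR = - ∫ θ in Ioo 0 Real.pi, f θ * φ (1, θ) := by
      rw [hE, setIntegral_rect iE, ← integral_neg]
      congr 1
      funext θ
      change ∫ x in Ico 1 2, f θ * fderiv ℝ φ (x, θ) eR = _
      rw [integral_const_mul, integral_Ico_eq_integral_Ioo, ← integral_Ioc_eq_integral_Ioo,
        ← intervalIntegral.integral_of_le (by norm_num),
        intervalIntegral.integral_eq_sub_of_hasDerivAt
          (fun x _ => hasDerivAt_fst_slice (hφ.differentiable (by simp)) x θ)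
          ((hcf.comp (by fun_prop : Continuous fun x : ℝ => (x, θ))).intervalIntegrable _ _)]
      have : φ (2, θ) = 0 := image_eq_zero_of_notMem_tsupport fun h => by
        have := (hφs h).1.2; norm_num at this
      rw [this]; ring
    rw [hVDE, setIntegral_union hdisj hEm (iu.mono_set hDV) (iu.mono_set hEV),
      setIntegral_union hdisj hEm (ig.mono_set hDV) (ig.mono_set hEV),
      setIntegral_congr_fun measurableSet_D huD, setIntegral_congr_fun hEm huE,
      setIntegral_congr_fun measurableSet_D hgD, setIntegral_congr_fun hEm hgE, hEint,
      integral_zero, add_zero]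
    linarith
  have hmain := ae_exists_eq_const_add_integral (x₀ := 1) (a := 0) (b := 2)
    ⟨by norm_num, by norm_num⟩ huloc hgloc hweak
  filter_upwards [hmain] with θ hθ r hr
  obtain ⟨hi, C, hC⟩ := hθ
  have hgp : ∀ r ∈ Ioo (0 : ℝ) 1, ∀ t ∈ uIoc r 1, t ≠ 1 → g (t, θ) = p (t, θ) := by
    intro r hr t ht ht1
    rw [uIoc_of_le hr.2.le] at ht
    exact piecewise_eq_of_mem _ _ _ (lt_of_le_of_ne ht.2 ht1)
  have hne : ∀ᵐ t : ℝ, t ≠ 1 := by simp [ae_iff]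
  -- For `r > 1` the extension equals `f θ` and its derivative is zero, which identifies the
  -- constant.
  have hC1 : C = f θ := by
    have h1 : ∀ᵐ x ∂volume.restrict (Ioo (1 : ℝ) 2), f θ = C := by
      filter_upwards [ae_restrict_of_ae_restrict_of_subset
        (Ioo_subset_Ioo_left (by norm_num : (0 : ℝ) ≤ 1)) hC, ae_restrict_mem measurableSet_Ioo]
        with x hx hxm
      have e1 : u (x, θ) = f θ := piecewise_eq_of_notMem _ _ _ (not_lt.2 hxm.1.le)
      have e2 : ∫ t in (1 : ℝ)..x, g (t, θ) = 0 := by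
        refine intervalIntegral.integral_zero_ae (.of_forall fun t ht => ?_)
        rw [uIoc_of_le hxm.1.le] at ht
        exact piecewise_eq_of_notMem _ _ _ (not_lt.2 ht.1.le)
      rw [e1, e2, add_zero] at hx
      exact hx
    have hne : NeBot (ae (volume.restrict (Ioo (1 : ℝ) 2))) := by
      rw [ae_neBot, Ne, Measure.restrict_eq_zero, Real.volume_Ioo]
      norm_num
    exact h1.exists.choose_spec.symm
  refine ⟨?_, ?_⟩
  · refine (hi r ⟨hr.1, by linarith [hr.2]⟩ 1 ⟨by norm_num, by norm_num⟩).congr_ae ?_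
    rw [EventuallyEq, ae_restrict_iff' measurableSet_uIoc]
    filter_upwards [hne] with t ht htm using hgp r hr t htm ht
  · filter_upwards [ae_restrict_of_ae_restrict_of_subset
        (Ioo_subset_Ioo_right (by norm_num : (1 : ℝ) ≤ 2)) hC, ae_restrict_mem measurableSet_Ioo]
        with x hx hxm
    have e1 : u (x, θ) = ψ (x, θ) := piecewise_eq_of_mem _ _ _ hxm.2
    have e2 : ∫ t in x..1, g (t, θ) = ∫ t in x..1, p (t, θ) := by
      refine intervalIntegral.integral_congr_ae ?_
      filter_upwards [hne] with t ht htm using hgp x hxm t htm ht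
    rw [e1, intervalIntegral.integral_symm, e2, hC1] at hx
    rw [hx]; ring

lemma locallyIntegrableOn_swap {F : ℝ × ℝ → ℝ} {s t : Set ℝ} (hs : IsOpen s) (ht : IsOpen t)
    (hF : LocallyIntegrableOn F (s ×ˢ t)) :
    LocallyIntegrableOn (fun z => F z.swap) (t ×ˢ s) := by
  refine (locallyIntegrableOn_iff (ht.prod hs).isLocallyClosed).2 fun K hK hKc => ?_
  have h1 : IntegrableOn F (Prod.swap ⁻¹' K) := by
    refine hF.integrableOn_compact_subset (fun z hz => ⟨(hK hz).2, (hK hz).1⟩) ?_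
    rw [← image_swap_eq_preimage_swap]
    exact hKc.image continuous_swap
  have hmp : MeasurePreserving (Prod.swap : ℝ × ℝ → ℝ × ℝ) volume volume :=
    Measure.measurePreserving_swap
  have := (hmp.integrableOn_comp_preimage
    (MeasurableEquiv.prodComm (α := ℝ) (β := ℝ)).measurableEmbedding (s := Prod.swap ⁻¹' K)).2 h1
  exact this

/-- A function with a weak derivative in the direction of `θ` is absolutely continuous on almost
every half circle. -/
theorem IsWeakDeriv.ae_exists_eq_const_add_integral {ψ q : ℝ × ℝ → ℝ}
    (h : IsWeakDeriv eTheta ψ q) :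
    ∀ᵐ r ∂volume.restrict (Ioo (0 : ℝ) 1),
      (∀ x ∈ Ioo 0 Real.pi, ∀ x' ∈ Ioo 0 Real.pi,
        IntervalIntegrable (fun t => q (r, t)) volume x x') ∧
      ∃ C, ∀ᵐ θ ∂volume.restrict (Ioo 0 Real.pi),
        ψ (r, θ) = C + ∫ t in (Real.pi / 2)..θ, q (r, t) := by
  have hpi := Real.pi_pos
  -- The result for the first variable, applied after exchanging the coordinates.
  refine OseenFrank.ae_exists_eq_const_add_integral (u := fun z => ψ z.swap)
    (g := fun z => q z.swap) ⟨by linarith, by linarith⟩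
    (locallyIntegrableOn_swap isOpen_Ioo isOpen_Ioo h.1)
    (locallyIntegrableOn_swap isOpen_Ioo isOpen_Ioo h.2.1) ?_
  intro φ hφ hφc hφs
  have hc : ContDiff ℝ ∞ fun z : ℝ × ℝ => φ z.swap := hφ.comp (contDiff_snd.prodMk contDiff_fst)
  have hts : tsupport (fun z : ℝ × ℝ => φ z.swap) ⊆ Prod.swap ⁻¹' tsupport φ :=
    closure_minimal (fun z hz => subset_tsupport _ hz)
      ((isClosed_tsupport φ).preimage continuous_swap)
  have hK : IsCompact (Prod.swap ⁻¹' tsupport φ) := by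
    rw [← image_swap_eq_preimage_swap]
    exact hφc.isCompact.image continuous_swap
  have hd : ∀ z, fderiv ℝ (fun z : ℝ × ℝ => φ z.swap) z eTheta = fderiv ℝ φ z.swap eR := by
    intro z
    exact (hasDerivAt_snd_slice (hc.differentiable (by simp)) z.1 z.2).unique
      (hasDerivAt_fst_slice (hφ.differentiable (by simp)) z.2 z.1)
  have := h.2.2 _ hc (HasCompactSupport.of_support_subset_isCompact hK
    ((subset_tsupport _).trans hts)) (hts.trans fun z hz => ⟨(hφs hz).2, (hφs hz).1⟩)
  simp only [hd] at this
  have e1 := setIntegral_prod_swap (μ := (volume : Measure ℝ)) (ν := (volume : Measure ℝ))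
    (Ioo (0 : ℝ) 1) (Ioo 0 Real.pi) (fun z : ℝ × ℝ => ψ z * fderiv ℝ φ z.swap eR)
  have e2 := setIntegral_prod_swap (μ := (volume : Measure ℝ)) (ν := (volume : Measure ℝ))
    (Ioo (0 : ℝ) 1) (Ioo 0 Real.pi) (fun z : ℝ × ℝ => q z * φ z.swap)
  rw [← Measure.volume_eq_prod] at e1 e2
  simp only [Prod.swap_swap] at e1 e2
  rw [e1, e2]
  exact this

/-! ### Functions of the angle alone -/

lemma memL2loc_of_continuousOn {F : ℝ × ℝ → ℝ} (hF : ContinuousOn F D) : MemL2loc F := by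
  intro K hK hKD
  obtain ⟨C, hC⟩ := hK.exists_bound_of_continuousOn (hF.mono hKD)
  have : IsFiniteMeasure (volume.restrict K) := isFiniteMeasure_restrict.2 hK.measure_lt_top.ne
  refine MemLp.of_bound ((hF.mono hKD).aestronglyMeasurable hK.measurableSet) C ?_
  filter_upwards [ae_restrict_mem hK.measurableSet] with z hz using hC z hz

lemma continuousOn_lift {f : ℝ → ℝ} (hf : ContinuousOn f (Ioo 0 Real.pi)) (s : Set ℝ) :
    ContinuousOn (lift f) (s ×ˢ Ioo 0 Real.pi) :=
  hf.comp continuousOn_snd fun _ hz => hz.2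

lemma locallyIntegrableOn_lift {f : ℝ → ℝ} (hf : ContinuousOn f (Ioo 0 Real.pi)) {s : Set ℝ}
    (hs : MeasurableSet s) : LocallyIntegrableOn (lift f) (s ×ˢ Ioo 0 Real.pi) :=
  (continuousOn_lift hf s).locallyIntegrableOn (hs.prod measurableSet_Ioo)

/-- Integrate in `r` first; `φ` vanishes at `r = 0`. This gives both the zero radial derivative,
when `φ` vanishes at `r = 1` as well, and the trace. -/
lemma setIntegral_lift_mul_fderiv {f : ℝ → ℝ} (hf : ContinuousOn f (Ioo 0 Real.pi))
    {φ : ℝ × ℝ → ℝ} (hφ : ContDiff ℝ ∞ φ) (hφc : HasCompactSupport φ)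
    (hφs : tsupport φ ⊆ Ioi 0 ×ˢ Ioo 0 Real.pi) :
    ∫ z in D, lift f z * fderiv ℝ φ z eR = ∫ θ in Ioo 0 Real.pi, f θ * φ (1, θ) := by
  have hcf := continuous_fderiv_apply hφ eR
  have hi : IntegrableOn (fun z => lift f z * fderiv ℝ φ z eR) D :=
    integrableOn_mul_of_isCompact (locallyIntegrableOn_lift hf measurableSet_Ioi) hφc.isCompact hφs
      measurableSet_D hcf fun z hz => fderiv_apply_eq_zero hz.2 _
  rw [D, setIntegral_rect hi]
  congr 1
  funext θ
  change ∫ x in Ioo 0 1, f θ * fderiv ℝ φ (x, θ) eR = _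
  rw [integral_const_mul, ← integral_Ioc_eq_integral_Ioo,
    ← intervalIntegral.integral_of_le (by norm_num),
    intervalIntegral.integral_eq_sub_of_hasDerivAt
      (fun x _ => hasDerivAt_fst_slice (hφ.differentiable (by simp)) x θ)
      ((hcf.comp (by fun_prop : Continuous fun x : ℝ => (x, θ))).intervalIntegrable _ _)]
  have : φ (0, θ) = 0 := image_eq_zero_of_notMem_tsupport fun h => lt_irrefl (0 : ℝ) (hφs h).1
  rw [this, sub_zero]

lemma isWeakDeriv_eR_lift {f : ℝ → ℝ} (hf : ContinuousOn f (Ioo 0 Real.pi)) :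
    IsWeakDeriv eR (lift f) 0 := by
  refine ⟨locallyIntegrableOn_lift hf measurableSet_Ioo,
    (locallyIntegrable_const (0 : ℝ)).locallyIntegrableOn _, fun φ hφ hφc hφs => ?_⟩
  rw [setIntegral_lift_mul_fderiv hf hφ hφc (hφs.trans (prod_mono (fun x hx => hx.1) subset_rfl))]
  have : ∀ θ, φ (1, θ) = 0 := fun θ =>
    image_eq_zero_of_notMem_tsupport fun h => lt_irrefl _ (hφs h).1.2
  simp [this]

lemma isWeakDeriv_eTheta_lift {f f' : ℝ → ℝ} (hf : ∀ θ ∈ Ioo 0 Real.pi, HasDerivAt f (f' θ) θ)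
    (hf' : ContinuousOn f' (Ioo 0 Real.pi)) : IsWeakDeriv eTheta (lift f) (lift f') := by
  have hfc : ContinuousOn f (Ioo 0 Real.pi) := fun θ hθ => (hf θ hθ).continuousAt.continuousWithinAt
  refine ⟨locallyIntegrableOn_lift hfc measurableSet_Ioo,
    locallyIntegrableOn_lift hf' measurableSet_Ioo, fun φ hφ hφc hφs => ?_⟩
  have hcf := continuous_fderiv_apply hφ eTheta
  have i0 : IntegrableOn (fun z => lift f z * φ z) univ :=
    integrableOn_mul_of_isCompact (locallyIntegrableOn_lift hfc measurableSet_Ioo) hφc.isCompact hφs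
      MeasurableSet.univ hφ.continuous fun z hz => image_eq_zero_of_notMem_tsupport hz.2
  have i1 : IntegrableOn (fun z => lift f z * fderiv ℝ φ z eTheta) univ :=
    integrableOn_mul_of_isCompact (locallyIntegrableOn_lift hfc measurableSet_Ioo) hφc.isCompact hφs
      MeasurableSet.univ hcf fun z hz => fderiv_apply_eq_zero hz.2 _
  have i2 : IntegrableOn (fun z => lift f' z * φ z) univ :=
    integrableOn_mul_of_isCompact (locallyIntegrableOn_lift hf' measurableSet_Ioo) hφc.isCompact hφs
      MeasurableSet.univ hφ.continuous fun z hz => image_eq_zero_of_notMem_tsupport hz.2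
  have h1 : ∫ z in univ, lift f z * fderiv ℝ φ z eTheta
      = ∫ z in D, lift f z * fderiv ℝ φ z eTheta :=
    setIntegral_eq_of_support_subset MeasurableSet.univ (subset_univ _)
      ((Function.support_mul_subset_right _ _).trans
        ((support_fderiv_apply_subset _).trans hφs))
  have h2 : ∫ z in univ, lift f' z * φ z = ∫ z in D, lift f' z * φ z :=
    setIntegral_eq_of_support_subset MeasurableSet.univ (subset_univ _)
      ((Function.support_mul_subset_right _ _).trans ((subset_tsupport φ).trans hφs))
  -- On each line `r = const` the integrand is the derivative of `f φ`. Working on the whole plane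
  -- avoids boundary terms.
  have h3 : ∫ z in univ, (lift f z * fderiv ℝ φ z eTheta + lift f' z * φ z) = 0 := by
    rw [setIntegral_univ]
    have i3 := i1.add i2
    rw [integrableOn_univ] at i3 i0
    rw [Measure.volume_eq_prod] at i3 i0 ⊢
    change ∫ z, ((fun z => lift f z * fderiv ℝ φ z eTheta) + fun z => lift f' z * φ z) z
      ∂volume.prod volume = 0
    rw [integral_prod _ i3]
    refine integral_eq_zero_of_ae ?_
    filter_upwards [i3.prod_right_ae, i0.prod_right_ae] with r hr hr0
    refine integral_eq_zero_of_hasDerivAt_of_integrable (f := fun θ => f θ * φ (r, θ)) ?_ hr hr0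
    intro θ
    by_cases hθ : (r, θ) ∈ tsupport φ
    · refine ((hf θ (hφs hθ).2).mul
        (hasDerivAt_snd_slice (hφ.differentiable (by simp)) r θ)).congr_deriv ?_
      simp only [Pi.add_apply, lift]; ring
    -- Off the support of `φ`, `f` need not be differentiable, but the product is locally zero.
    · have e : (fun θ => f θ * φ (r, θ)) =ᶠ[𝓝 θ] fun _ => 0 := by
        have ho : IsOpen {s | (r, s) ∉ tsupport φ} :=
          (isClosed_tsupport φ).isOpen_compl.preimage (by fun_prop : Continuous fun s : ℝ => (r, s))
        filter_upwards [ho.mem_nhds hθ] with s hs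
        rw [image_eq_zero_of_notMem_tsupport hs, mul_zero]
      have e0 : (fun z => lift f z * fderiv ℝ φ z eTheta) (r, θ)
          + (fun z => lift f' z * φ z) (r, θ) = 0 := by
        simp only [fderiv_apply_eq_zero hθ, image_eq_zero_of_notMem_tsupport hθ, mul_zero, add_zero]
      rw [Pi.add_apply, e0]
      exact (hasDerivAt_const θ (0 : ℝ)).congr_of_eventuallyEq e
  rw [integral_add i1 i2, h1, h2] at h3
  linarith

lemma hasTrace_lift {f : ℝ → ℝ} (hf : ContinuousOn f (Ioo 0 Real.pi)) : HasTrace (lift f) f := by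
  have hae := weakDeriv_ae_eq (isWeakDeriv_eR_lift hf)
  refine ⟨hf.locallyIntegrableOn measurableSet_Ioo, locallyIntegrableOn_lift hf measurableSet_Ioc,
    ?_, fun φ hφ hφc hφs => ?_⟩
  · refine IntegrableOn.locallyIntegrableOn ?_
    have h0 : IntegrableOn (0 : ℝ × ℝ → ℝ) (Ioc 0 1 ×ˢ Ioo 0 Real.pi) := integrableOn_zero
    refine h0.congr ?_
    -- The edge `r = 1` is a null set, so the information on `D` suffices.
    rw [restrict_prod, ← Measure.restrict_congr_set (Ioo_ae_eq_Ioc (μ := volume)), ← restrict_prod]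
    exact hae.symm
  · rw [← setIntegral_lift_mul_fderiv hf hφ hφc hφs]
    refine integral_congr_ae ?_
    filter_upwards [hae] with z hz
    rw [hz]; simp

/-! ### Finite energy of the minimizers -/

section memX

lemma mul_pi_sub_le_sin {x : ℝ} (h0 : 0 ≤ x) (h1 : x ≤ Real.pi) :
    x * (Real.pi - x) ≤ Real.pi ^ 2 / 2 * Real.sin x := by
  have hpi := Real.pi_pos
  rcases le_total x (Real.pi / 2) with h | h
  · have := Real.mul_le_sin h0 h
    calc x * (Real.pi - x) ≤ x * Real.pi := by gcongr; linarith
      _ = Real.pi ^ 2 / 2 * (2 / Real.pi * x) := by field_simp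
      _ ≤ _ := by gcongr
  · have := Real.mul_le_sin (x := Real.pi - x) (by linarith) (by linarith)
    rw [Real.sin_pi_sub] at this
    calc x * (Real.pi - x) ≤ Real.pi * (Real.pi - x) := by gcongr
      _ = Real.pi ^ 2 / 2 * (2 / Real.pi * (Real.pi - x)) := by field_simp
      _ ≤ _ := by gcongr

variable {k₁ k₃ t : ℝ} (hk₁ : 0 < k₁) (hk₃ : 0 < k₃) {f : ℝ → ℝ}

include hk₁ hk₃

/-- By monotonicity `f θ` and `θ` both keep a distance from `π` for `θ ≤ π / 2`, and both from 0 for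
`θ ≥ π / 2`. In the first case each is bounded by a multiple of its sine, in the second its distance
to `π` is. -/
lemma IsPsi.abs_sub_le (hf : IsPsi k₁ k₃ t f) (ht : t ∈ Ioo 0 Real.pi) :
    ∃ C, 0 ≤ C ∧ ∀ θ ∈ Ioo 0 Real.pi, |f θ - θ| ≤ C * (Real.sin (f θ) + Real.sin θ) := by
  have hpi := Real.pi_pos
  have ht0 := ht.1
  have ht1 : 0 < Real.pi - t := sub_pos.2 ht.2
  have hmid : Real.pi / 2 ∈ Ioo 0 Real.pi := ⟨by linarith, by linarith⟩
  set c := min (min t (Real.pi - t)) (Real.pi / 2) with hc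
  have hc0 : 0 < c := lt_min (lt_min ht0 ht1) (by positivity)
  have hcle : c ≤ t ∧ c ≤ Real.pi - t ∧ c ≤ Real.pi / 2 :=
    ⟨(min_le_left _ _).trans (min_le_left _ _), (min_le_left _ _).trans (min_le_right _ _),
      min_le_right _ _⟩
  have hleft : ∀ x, 0 ≤ x → x ≤ Real.pi - c → x ≤ Real.pi ^ 2 / 2 / c * Real.sin x := by
    intro x h0 h1
    have := mul_pi_sub_le_sin h0 (by linarith)
    rw [div_mul_eq_mul_div, le_div_iff₀ hc0]
    nlinarith
  have hright : ∀ x, c ≤ x → x ≤ Real.pi → Real.pi - x ≤ Real.pi ^ 2 / 2 / c * Real.sin x := by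
    intro x h0 h1
    have := mul_pi_sub_le_sin (by linarith) h1
    rw [div_mul_eq_mul_div, le_div_iff₀ hc0]
    nlinarith
  refine ⟨Real.pi ^ 2 / 2 / c, by positivity, fun θ hθ => ?_⟩
  have hfθ := hf.mem_Ioo hk₁ hk₃ ht hθ
  have hmono := hf.monotoneOn hk₁ hk₃ ht
  have hmidv : f (Real.pi / 2) = t := hf.2
  rcases le_total θ (Real.pi / 2) with h | h
  · have h1 := hmono hθ hmid h
    have h2 := hleft (f θ) hfθ.1.le (by linarith)
    have h3 := hleft θ hθ.1.le (by linarith)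
    rw [mul_add, abs_le]
    constructor <;> linarith [hfθ.1, hθ.1]
  · have h1 := hmono hmid hθ h
    have h2 := hright (f θ) (by linarith) hfθ.2.le
    have h3 := hright θ (by linarith) hθ.2.le
    rw [mul_add, abs_le]
    constructor <;> linarith [hfθ.2, hθ.2]

lemma IsPsi.integrableOn_slope_mul_sin (hf : IsPsi k₁ k₃ t f) (ht : t ∈ Ioo 0 Real.pi) :
    IntegrableOn (fun θ => slope k₁ k₃ θ (f θ) * Real.sin (f θ)) (Ioo 0 Real.pi) := by
  have hpi := Real.pi_pos
  obtain ⟨α, β, -, -, hαβ, hex⟩ := exists_exhaustion (a := 0) (b := Real.pi) (x₀ := Real.pi / 2)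
    ⟨by linarith, by linarith⟩
  have hc : ContinuousOn (fun θ => slope k₁ k₃ θ (f θ) * Real.sin (f θ)) (Ioo 0 Real.pi) :=
    (hf.continuousOn_slope hk₁ hk₃).mul (Real.continuous_sin.comp_continuousOn hf.continuousOn)
  have hsub : ∀ n, Icc (α n) (β n) ⊆ Ioo 0 Real.pi := fun n x hx =>
    ⟨(hαβ n).1.1.trans_le hx.1, hx.2.trans_lt (hαβ n).2.2⟩
  have hle : ∀ n, α n ≤ β n := fun n => ((hαβ n).1.2.trans (hαβ n).2.1).le
  have hcover : AECover (volume.restrict (Ioo 0 Real.pi)) atTop fun n => Icc (α n) (β n) := by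
    refine ⟨?_, fun n => measurableSet_Icc⟩
    filter_upwards [ae_restrict_mem measurableSet_Ioo] with x hx
    obtain ⟨N, hN⟩ := hex x hx
    exact eventually_atTop.2 ⟨N, fun n hn => Ioo_subset_Icc_self (hN n hn)⟩
  have hrr : ∀ n, (volume.restrict (Ioo 0 Real.pi)).restrict (Icc (α n) (β n))
      = volume.restrict (Icc (α n) (β n)) := fun n => by
    rw [Measure.restrict_restrict measurableSet_Icc, inter_eq_left.2 (hsub n)]
  -- The integrand is nonnegative with primitive `-cos f`, whose increments are at most 2.
  refine hcover.integrable_of_integral_norm_bounded 2 (fun n => ?_) (.of_forall fun n => ?_)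
  · rw [IntegrableOn, hrr]
    exact (hc.mono (hsub n)).integrableOn_Icc
  · rw [hrr, integral_Icc_eq_integral_Ioc, ← intervalIntegral.integral_of_le (hle n)]
    have e : ∫ θ in (α n)..(β n), ‖slope k₁ k₃ θ (f θ) * Real.sin (f θ)‖
        = ∫ θ in (α n)..(β n), slope k₁ k₃ θ (f θ) * Real.sin (f θ) := by
      refine intervalIntegral.integral_congr fun θ hθ => ?_
      rw [uIcc_of_le (hle n)] at hθ
      have hθ' := hsub n hθ
      exact Real.norm_of_nonneg (mul_nonneg (hf.slope_nonneg hk₁ hk₃ ht hθ')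
        (Real.sin_pos_of_mem_Ioo (hf.mem_Ioo hk₁ hk₃ ht hθ')).le)
    rw [e, intervalIntegral.integral_eq_sub_of_hasDerivAt (f := fun θ => - Real.cos (f θ))]
    · linarith [Real.neg_one_le_cos (f (β n)), Real.cos_le_one (f (α n))]
    · intro θ hθ
      rw [uIcc_of_le (hle n)] at hθ
      refine (hf.hasDerivAt (hsub n hθ)).cos.neg.congr_deriv ?_
      ring
    · refine ContinuousOn.intervalIntegrable ?_
      rw [uIcc_of_le (hle n)]
      exact hc.mono (hsub n)

theorem IsPsi.memX (hf : IsPsi k₁ k₃ t f) (ht : t ∈ Ioo 0 Real.pi) : MemX 1 (lift f) := by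
  have hfc := hf.continuousOn
  have hfc' := hf.continuousOn_slope hk₁ hk₃
  have hR := isWeakDeriv_eR_lift hfc
  have hT := isWeakDeriv_eTheta_lift (fun θ hθ => hf.hasDerivAt hθ) hfc'
  refine ⟨⟨memL2loc_of_continuousOn (continuousOn_lift hfc _),
    ⟨_, hR, memL2loc_of_continuousOn continuousOn_const⟩,
    ⟨_, hT, memL2loc_of_continuousOn (continuousOn_lift hfc' _)⟩⟩, ?_⟩
  have hI := hf.integrableOn_slope_mul_sin hk₁ hk₃ ht
  obtain ⟨C, hC0, hC⟩ := hf.abs_sub_le hk₁ hk₃ ht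
  set e : ℝ → ℝ := fun θ =>
    slope k₁ k₃ θ (f θ) ^ 2 * Real.sin θ + (f θ - θ) ^ 2 / Real.sin θ with he
  have hec : ContinuousOn e (Ioo 0 Real.pi) := by
    refine (ContinuousOn.mul (hfc'.pow 2) Real.continuous_sin.continuousOn).add ?_
    exact ((hfc.sub continuousOn_id).pow 2).div Real.continuous_sin.continuousOn
      fun θ hθ => (Real.sin_pos_of_mem_Ioo hθ).ne'
  set c := √(min k₁ k₃) with hcdef
  have hc : 0 < c := Real.sqrt_pos.2 (lt_min hk₁ hk₃)
  have hk := Real.sqrt_pos.2 hk₁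
  have hei : IntegrableOn e (Ioo 0 Real.pi) := by
    have hfin : IntegrableOn (fun _ : ℝ => (1 : ℝ)) (Ioo 0 Real.pi) :=
      integrableOn_const (by simp)
    refine Integrable.mono' ((hI.const_mul (√k₁ / c + 2 * C ^ 2 * (√(max k₁ k₃) / √k₁))).add
      (hfin.const_mul (2 * C ^ 2))) (hec.aestronglyMeasurable measurableSet_Ioo) ?_
    filter_upwards [ae_restrict_mem measurableSet_Ioo] with θ hθ
    have hσ := Real.sin_pos_of_mem_Ioo hθ
    have hsf := Real.sin_pos_of_mem_Ioo (hf.mem_Ioo hk₁ hk₃ ht hθ)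
    have hs0 := hf.slope_nonneg hk₁ hk₃ ht hθ
    have hm := modulus_pos hk₁ hk₃ (f θ - θ)
    have hm1 := sqrt_min_le_modulus (k₁ := k₁) (k₃ := k₃) (f θ - θ)
    have hm2 := modulus_le (k₁ := k₁) (k₃ := k₃) (f θ - θ)
    have hpos : 0 ≤ e θ := by simp only [he]; positivity
    rw [Real.norm_of_nonneg hpos]
    -- The differential equation read in two ways: it trades a factor `f' sin θ` for `sin f`, and
    -- `sin f / sin θ` for `f'`. Every term of the energy is thus bounded by `f' sin f` and a
    -- constant.
    have e1 : slope k₁ k₃ θ (f θ) * Real.sin θ = √k₁ / modulus k₁ k₃ (f θ - θ) * Real.sin (f θ) := by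
      unfold slope; field_simp
    have e2 : Real.sin (f θ) / Real.sin θ
        = modulus k₁ k₃ (f θ - θ) / √k₁ * slope k₁ k₃ θ (f θ) := by
      unfold slope; field_simp
    have b1 : slope k₁ k₃ θ (f θ) ^ 2 * Real.sin θ
        ≤ √k₁ / c * (slope k₁ k₃ θ (f θ) * Real.sin (f θ)) := by
      calc _ = slope k₁ k₃ θ (f θ) * (slope k₁ k₃ θ (f θ) * Real.sin θ) := by ring
        _ = √k₁ / modulus k₁ k₃ (f θ - θ) * (slope k₁ k₃ θ (f θ) * Real.sin (f θ)) := by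
            rw [e1]; ring
        _ ≤ _ := by gcongr
    have b2 : Real.sin (f θ) ^ 2 / Real.sin θ
        ≤ √(max k₁ k₃) / √k₁ * (slope k₁ k₃ θ (f θ) * Real.sin (f θ)) := by
      calc _ = Real.sin (f θ) * (Real.sin (f θ) / Real.sin θ) := by ring
        _ = modulus k₁ k₃ (f θ - θ) / √k₁ * (slope k₁ k₃ θ (f θ) * Real.sin (f θ)) := by
            rw [e2]; ring
        _ ≤ _ := by gcongr
    have b3 : (f θ - θ) ^ 2 / Real.sin θ
        ≤ 2 * C ^ 2 * (Real.sin (f θ) ^ 2 / Real.sin θ) + 2 * C ^ 2 * 1 := by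
      have h1 : (f θ - θ) ^ 2 ≤ (C * (Real.sin (f θ) + Real.sin θ)) ^ 2 := by
        rw [← sq_abs]; exact pow_le_pow_left₀ (abs_nonneg _) (hC θ hθ) 2
      have h2 : (f θ - θ) ^ 2 ≤ 2 * C ^ 2 * Real.sin (f θ) ^ 2 + 2 * C ^ 2 * Real.sin θ ^ 2 := by
        nlinarith [mul_nonneg (sq_nonneg C) (sq_nonneg (Real.sin (f θ) - Real.sin θ))]
      calc _ ≤ (2 * C ^ 2 * Real.sin (f θ) ^ 2 + 2 * C ^ 2 * Real.sin θ ^ 2) / Real.sin θ := by gcongr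
        _ = 2 * C ^ 2 * (Real.sin (f θ) ^ 2 / Real.sin θ) + 2 * C ^ 2 * Real.sin θ := by field_simp
        _ ≤ _ := by gcongr; exact Real.sin_le_one θ
    have b4 := mul_le_mul_of_nonneg_left b2 (by positivity : 0 ≤ 2 * C ^ 2)
    simp only [he, Pi.add_apply]
    linarith
  have heD : IntegrableOn (fun z : ℝ × ℝ => e z.2) D := by
    rw [D, IntegrableOn, restrict_prod]
    exact Integrable.comp_snd hei _
  refine heD.congr ?_
  filter_upwards [weakDeriv_ae_eq hR, weakDeriv_ae_eq hT, ae_restrict_mem measurableSet_D]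
    with z h1 h2 hz
  have hr : 0 < z.1 := hz.1.1
  have hσ := Real.sin_pos_of_mem_Ioo hz.2
  rw [h1, h2]
  simp only [he, lift, Pi.zero_apply]
  push_cast
  field_simp
  ring

end memX

/-! ### Pointwise domination by the energy -/

/-- A function dominating, up to constants, all terms in the energy identity. -/
noncomputable def majorant (r θ s p q : ℝ) : ℝ :=
  (r * p) ^ 2 * Real.sin θ + q ^ 2 * Real.sin θ + (s - θ) ^ 2 / Real.sin θ + Real.sin θ

/-- The radial part of the calibrating null Lagrangian, completed by the radial potential. -/
noncomputable def radialTerm (k₁ k₃ r θ s p : ℝ) : ℝ :=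
  r * Real.sin s * modulusDeriv k₁ k₃ (s - θ) * p + radialPotential k₁ k₃ (s - θ) θ

/-- The angular part of the calibrating null Lagrangian, completed by the radial potential. -/
noncomputable def angularTerm (k₁ k₃ θ s q : ℝ) : ℝ :=
  Real.sin s * modulus k₁ k₃ (s - θ) * q - radialPotential k₁ k₃ (s - θ) θ

section pointwise

variable {k₁ k₃ : ℝ}

lemma abs_sub_le_half {θ s : ℝ} (hθ : 0 < Real.sin θ) :
    |s - θ| ≤ ((s - θ) ^ 2 / Real.sin θ + Real.sin θ) / 2 := by
  have h : |s - θ| * Real.sin θ ≤ ((s - θ) ^ 2 + Real.sin θ ^ 2) / 2 := by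
    rw [← sq_abs]; nlinarith [sq_nonneg (|s - θ| - Real.sin θ)]
  have e : ((s - θ) ^ 2 / Real.sin θ + Real.sin θ) / 2
      = ((s - θ) ^ 2 + Real.sin θ ^ 2) / 2 / Real.sin θ := by field_simp
  rw [e, le_div_iff₀ hθ]; exact h

lemma sin_sq_le (θ s : ℝ) : Real.sin s ^ 2 ≤ 2 * (s - θ) ^ 2 + 2 * Real.sin θ ^ 2 := by
  have h := abs_sin_add_sub_sin_le (s - θ) θ
  rw [sub_add_cancel] at h
  have h2 := pow_le_pow_left₀ (abs_nonneg _) h 2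
  rw [sq_abs, sq_abs] at h2
  nlinarith [sq_nonneg (Real.sin s - 2 * Real.sin θ)]

/-- Young's inequality with weight `sin θ`, followed by `sin_sq_le`. -/
lemma abs_sin_mul_le {θ s X : ℝ} (hθ : 0 < Real.sin θ) :
    |Real.sin s| * |X| ≤ (s - θ) ^ 2 / Real.sin θ + Real.sin θ + X ^ 2 * Real.sin θ / 2 := by
  have h1 : |Real.sin s| * |X| * Real.sin θ
      ≤ (Real.sin s ^ 2 + X ^ 2 * Real.sin θ ^ 2) / 2 := by
    rw [← sq_abs (Real.sin s), ← sq_abs X]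
    nlinarith [sq_nonneg (|Real.sin s| - |X| * Real.sin θ)]
  have e : (s - θ) ^ 2 / Real.sin θ + Real.sin θ + X ^ 2 * Real.sin θ / 2
      = ((s - θ) ^ 2 + Real.sin θ ^ 2 + X ^ 2 * Real.sin θ ^ 2 / 2) / Real.sin θ := by field_simp
  rw [e, le_div_iff₀ hθ]
  linarith [sin_sq_le θ s]

lemma abs_sub_le_majorant {r θ s p q : ℝ} (hθ : 0 < Real.sin θ) :
    |s - θ| ≤ majorant r θ s p q := by
  have h1 := abs_sub_le_half (s := s) hθ
  have h2 : 0 ≤ (r * p) ^ 2 * Real.sin θ := by positivity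
  have h3 : 0 ≤ q ^ 2 * Real.sin θ := by positivity
  have h4 : 0 ≤ (s - θ) ^ 2 / Real.sin θ := by positivity
  unfold majorant
  linarith

lemma abs_angularPotential_div_le {r θ s p q : ℝ} (hθ : 0 < Real.sin θ) :
    |angularPotential k₁ k₃ (s - θ) θ| / Real.sin θ
      ≤ 2 * √(max k₁ k₃) * majorant r θ s p q := by
  have h := abs_angularPotential_le (k₁ := k₁) (k₃ := k₃) (s - θ) θ
  rw [abs_of_pos hθ] at h
  have hM : 0 ≤ √(max k₁ k₃) := Real.sqrt_nonneg _
  have h1 := abs_sub_le_majorant (r := r) (s := s) (p := p) (q := q) hθ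
  have h4 : (s - θ) ^ 2 / Real.sin θ ≤ majorant r θ s p q := by
    have h2 : 0 ≤ (r * p) ^ 2 * Real.sin θ := by positivity
    have h3 : 0 ≤ q ^ 2 * Real.sin θ := by positivity
    unfold majorant
    linarith
  calc _ ≤ √(max k₁ k₃) * ((s - θ) ^ 2 + |s - θ| * Real.sin θ) / Real.sin θ := by gcongr
    _ = √(max k₁ k₃) * ((s - θ) ^ 2 / Real.sin θ + |s - θ|) := by field_simp
    _ ≤ √(max k₁ k₃) * (majorant r θ s p q + majorant r θ s p q) := by gcongr
    _ = _ := by ring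

variable (hk₁ : 0 < k₁) (hk₃ : 0 < k₃)

include hk₁ hk₃

lemma exists_radialPotential_le : ∃ C, 0 ≤ C ∧ ∀ r θ s p q : ℝ, 0 < Real.sin θ →
    |radialPotential k₁ k₃ (s - θ) θ| ≤ C * majorant r θ s p q := by
  refine ⟨3 * √(max k₁ k₃) + |k₃ - k₁| / √(min k₁ k₃), by positivity, fun r θ s p q hθ => ?_⟩
  refine (abs_radialPotential_le hk₁ hk₃ _ _).trans ?_
  gcongr
  exact abs_sub_le_majorant hθ

lemma exists_radialTerm_le : ∃ C, ∀ r θ s p q : ℝ, 0 < Real.sin θ →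
    |radialTerm k₁ k₃ r θ s p| ≤ C * majorant r θ s p q := by
  obtain ⟨C, hC, h⟩ := exists_radialPotential_le hk₁ hk₃
  refine ⟨|k₃ - k₁| / √(min k₁ k₃) + C, fun r θ s p q hθ => ?_⟩
  refine (abs_add_le _ _).trans ?_
  rw [add_mul]
  refine add_le_add ?_ (h r θ s p q hθ)
  have e : |r * Real.sin s * modulusDeriv k₁ k₃ (s - θ) * p|
      = |modulusDeriv k₁ k₃ (s - θ)| * (|Real.sin s| * |r * p|) := by
    simp only [abs_mul]; ring
  rw [e]
  gcongr
  · exact abs_modulusDeriv_le hk₁ hk₃ _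
  · refine (abs_sin_mul_le hθ).trans ?_
    have h2 : 0 ≤ (r * p) ^ 2 * Real.sin θ := by positivity
    have h3 : 0 ≤ q ^ 2 * Real.sin θ := by positivity
    unfold majorant
    linarith

lemma exists_angularTerm_le : ∃ C, ∀ r θ s p q : ℝ, 0 < Real.sin θ →
    |angularTerm k₁ k₃ θ s q| ≤ C * majorant r θ s p q := by
  obtain ⟨C, hC, h⟩ := exists_radialPotential_le hk₁ hk₃
  refine ⟨√(max k₁ k₃) + C, fun r θ s p q hθ => ?_⟩
  refine (abs_sub _ _).trans ?_
  rw [add_mul]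
  refine add_le_add ?_ (h r θ s p q hθ)
  have e : |Real.sin s * modulus k₁ k₃ (s - θ) * q|
      = |modulus k₁ k₃ (s - θ)| * (|Real.sin s| * |q|) := by
    simp only [abs_mul]; ring
  rw [e]
  gcongr
  · exact abs_modulus_le _
  · refine (abs_sin_mul_le hθ).trans ?_
    have h2 : 0 ≤ (r * p) ^ 2 * Real.sin θ := by positivity
    have h3 : 0 ≤ q ^ 2 * Real.sin θ := by positivity
    unfold majorant
    linarith

lemma exists_density_le : ∃ C, ∀ r θ s p q : ℝ, 0 < r → 0 < Real.sin θ →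
    |density k₁ k₃ r θ s p q * (r ^ 2 * Real.sin θ)| ≤ C * majorant r θ s p q := by
  refine ⟨2 * (k₁ + k₃), fun r θ s p q hr hθ => ?_⟩
  have e : density k₁ k₃ r θ s p q * (r ^ 2 * Real.sin θ)
      = Real.sin θ * quadForm k₁ k₃ (s - θ) (r * p) q + k₁ * (Real.sin s ^ 2 / Real.sin θ) := by
    unfold density quadForm
    field_simp
    ring
  have h0 := quadForm_nonneg hk₁ hk₃ (s - θ) (r * p) q
  have h1 : quadForm k₁ k₃ (s - θ) (r * p) q ≤ (k₁ + k₃) * ((r * p) ^ 2 + q ^ 2) := by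
    -- Exchanging `k₁` and `k₃` gives the complementary form; the two add up to `k₁ + k₃` times the
    -- Euclidean norm squared.
    have e2 : (k₁ + k₃) * ((r * p) ^ 2 + q ^ 2) - quadForm k₁ k₃ (s - θ) (r * p) q
        = k₃ * (Real.cos (s - θ) * q - Real.sin (s - θ) * (r * p)) ^ 2
          + k₁ * (Real.cos (s - θ) * (r * p) + Real.sin (s - θ) * q) ^ 2 := by
      unfold quadForm
      linear_combination (-(k₁ + k₃) * ((r * p) ^ 2 + q ^ 2)) * Real.sin_sq_add_cos_sq (s - θ)
    have : 0 ≤ k₃ * (Real.cos (s - θ) * q - Real.sin (s - θ) * (r * p)) ^ 2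
          + k₁ * (Real.cos (s - θ) * (r * p) + Real.sin (s - θ) * q) ^ 2 := by positivity
    linarith
  have h2 : Real.sin s ^ 2 / Real.sin θ ≤ 2 * ((s - θ) ^ 2 / Real.sin θ) + 2 * Real.sin θ := by
    have e3 : 2 * ((s - θ) ^ 2 / Real.sin θ) + 2 * Real.sin θ
        = (2 * (s - θ) ^ 2 + 2 * Real.sin θ ^ 2) / Real.sin θ := by field_simp
    rw [e3]
    gcongr
    exact sin_sq_le θ s
  rw [e, abs_of_nonneg (by positivity)]
  have h3 := mul_le_mul_of_nonneg_left h1 hθ.le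
  have h4 := mul_le_mul_of_nonneg_left h2 hk₁.le
  have h5 : 0 ≤ (k₁ + k₃) * ((r * p) ^ 2 * Real.sin θ + q ^ 2 * Real.sin θ) := by positivity
  have h6 : 0 ≤ k₃ * ((s - θ) ^ 2 / Real.sin θ + Real.sin θ) := by positivity
  unfold majorant
  linarith

end pointwise

/-! ### Integrability of all terms for functions of finite energy -/

section integrability

variable {k₁ k₃ : ℝ}

lemma measurable_modulus : Measurable (modulus k₁ k₃) := continuous_modulus.measurable

lemma measurable_modulusDeriv : Measurable (modulusDeriv k₁ k₃) :=
  (((measurable_const.mul Real.measurable_sin).mul Real.measurable_cos)).div measurable_modulus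

lemma AEMeasurable.radialPotential {μ : Measure (ℝ × ℝ)} {w θ : ℝ × ℝ → ℝ} (hw : AEMeasurable w μ)
    (hθ : AEMeasurable θ μ) :
    AEMeasurable (fun z => radialPotential k₁ k₃ (w z) (θ z)) μ := by
  have h1 := contDiff_sinPrimitive (k₁ := k₁) (k₃ := k₃).continuous.measurable.comp_aemeasurable hw
  have h2 := contDiff_cosPrimitive (k₁ := k₁) (k₃ := k₃).continuous.measurable.comp_aemeasurable hw
  have h3 := (measurable_modulus (k₁ := k₁) (k₃ := k₃)).comp_aemeasurable hw
  have h4 := Real.measurable_sin.comp_aemeasurable hθ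
  have h5 := Real.measurable_cos.comp_aemeasurable hθ
  have h6 := Real.measurable_sin.comp_aemeasurable (hw.add hθ)
  exact (((h6.mul h3).sub (h4.mul_const _)).add (h4.mul h1)).sub (h5.mul h2)

variable {ψ p q : ℝ × ℝ → ℝ}

/-- The integrability properties shared by all functions in the class `X₁`, for given weak
derivatives `p`, `q`. -/
structure FiniteEnergy (ψ p q : ℝ × ℝ → ℝ) : Prop where
  aemeasurable : AEMeasurable ψ (volume.restrict D)
  aemeasurable_fst : AEMeasurable p (volume.restrict D)
  aemeasurable_snd : AEMeasurable q (volume.restrict D)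
  integrableOn : IntegrableOn (fun z => majorant z.1 z.2 (ψ z) (p z) (q z)) D

lemma MemX.finiteEnergy (h : MemX 1 ψ) : FiniteEnergy ψ (weakDeriv eR ψ) (weakDeriv eTheta ψ) := by
  obtain ⟨⟨-, ⟨g₁, hg₁, -⟩, ⟨g₂, hg₂, -⟩⟩, hint⟩ := h
  have h1 := isWeakDeriv_weakDeriv ⟨g₁, hg₁⟩
  have h2 := isWeakDeriv_weakDeriv ⟨g₂, hg₂⟩
  refine ⟨h1.1.aestronglyMeasurable.aemeasurable, h1.2.1.aestronglyMeasurable.aemeasurable,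
    h2.2.1.aestronglyMeasurable.aemeasurable, ?_⟩
  have hD : IntegrableOn (fun z : ℝ × ℝ => Real.sin z.2) D := by
    have hfin : volume D < ⊤ := by
      rw [D, Measure.volume_eq_prod, Measure.prod_prod]
      simp
    refine (integrableOn_const (C := (1 : ℝ)) hfin.ne).mono' (by fun_prop) ?_
    exact .of_forall fun z => Real.abs_sin_le_one _
  refine (hint.add hD).congr ?_
  filter_upwards [ae_restrict_mem measurableSet_D] with z hz
  have hr : 0 < z.1 := hz.1.1
  have hσ := Real.sin_pos_of_mem_Ioo hz.2
  simp only [majorant, Pi.add_apply]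
  push_cast
  field_simp

lemma FiniteEnergy.integrableOn_of_le (h : FiniteEnergy ψ p q) {F : ℝ × ℝ → ℝ}
    (hF : AEMeasurable F (volume.restrict D)) {C : ℝ}
    (hC : ∀ z ∈ D, |F z| ≤ C * majorant z.1 z.2 (ψ z) (p z) (q z)) : IntegrableOn F D := by
  refine Integrable.mono' (h.integrableOn.const_mul C) hF.aestronglyMeasurable ?_
  filter_upwards [ae_restrict_mem measurableSet_D] with z hz using hC z hz

lemma FiniteEnergy.aemeasurable_sub (h : FiniteEnergy ψ p q) :
    AEMeasurable (fun z => ψ z - z.2) (volume.restrict D) :=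
  h.aemeasurable.sub measurable_snd.aemeasurable

lemma FiniteEnergy.integrableOn_angularPotential (h : FiniteEnergy ψ p q) :
    IntegrableOn (fun z => angularPotential k₁ k₃ (ψ z - z.2) z.2 / Real.sin z.2) D := by
  refine h.integrableOn_of_le (C := 2 * √(max k₁ k₃)) ?_ fun z hz => ?_
  · have h1 : Measurable fun x : ℝ × ℝ => angularPotential k₁ k₃ x.1 x.2 / Real.sin x.2 :=
      contDiff_angularPotential.continuous.measurable.div
        (Real.measurable_sin.comp measurable_snd)
    exact h1.comp_aemeasurable (h.aemeasurable_sub.prodMk measurable_snd.aemeasurable)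
  · have hσ := Real.sin_pos_of_mem_Ioo hz.2
    rw [abs_div, abs_of_pos hσ]
    exact abs_angularPotential_div_le hσ

variable (hk₁ : 0 < k₁) (hk₃ : 0 < k₃)

include hk₁ hk₃

lemma FiniteEnergy.integrableOn_radialPotential (h : FiniteEnergy ψ p q) :
    IntegrableOn (fun z => radialPotential k₁ k₃ (ψ z - z.2) z.2) D := by
  obtain ⟨C, -, hC⟩ := exists_radialPotential_le hk₁ hk₃
  exact h.integrableOn_of_le (AEMeasurable.radialPotential h.aemeasurable_sub
    measurable_snd.aemeasurable) fun z hz => hC _ _ _ _ _ (Real.sin_pos_of_mem_Ioo hz.2)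

lemma FiniteEnergy.integrableOn_radialTerm (h : FiniteEnergy ψ p q) :
    IntegrableOn (fun z => radialTerm k₁ k₃ z.1 z.2 (ψ z) (p z)) D := by
  obtain ⟨C, hC⟩ := exists_radialTerm_le hk₁ hk₃
  refine h.integrableOn_of_le ?_ fun z hz => hC _ _ _ _ _ (Real.sin_pos_of_mem_Ioo hz.2)
  exact (((measurable_fst.aemeasurable.mul
    (Real.measurable_sin.comp_aemeasurable h.aemeasurable)).mul
    (measurable_modulusDeriv.comp_aemeasurable h.aemeasurable_sub)).mul h.aemeasurable_fst).add
    (AEMeasurable.radialPotential h.aemeasurable_sub measurable_snd.aemeasurable)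

lemma FiniteEnergy.integrableOn_angularTerm (h : FiniteEnergy ψ p q) :
    IntegrableOn (fun z => angularTerm k₁ k₃ z.2 (ψ z) (q z)) D := by
  obtain ⟨C, hC⟩ := exists_angularTerm_le hk₁ hk₃
  refine h.integrableOn_of_le ?_ fun z hz => hC _ _ _ _ _ (Real.sin_pos_of_mem_Ioo hz.2)
  exact (((Real.measurable_sin.comp_aemeasurable h.aemeasurable).mul
    (measurable_modulus.comp_aemeasurable h.aemeasurable_sub)).mul h.aemeasurable_snd).sub
    (AEMeasurable.radialPotential h.aemeasurable_sub measurable_snd.aemeasurable)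

lemma FiniteEnergy.integrableOn_density (h : FiniteEnergy ψ p q) :
    IntegrableOn (fun z => density k₁ k₃ z.1 z.2 (ψ z) (p z) (q z)
      * (z.1 ^ 2 * Real.sin z.2)) D := by
  obtain ⟨C, hC⟩ := exists_density_le hk₁ hk₃
  refine h.integrableOn_of_le ?_ fun z hz => hC _ _ _ _ _ hz.1.1 (Real.sin_pos_of_mem_Ioo hz.2)
  have h1 := h.aemeasurable
  have h2 := h.aemeasurable_fst
  have h3 := h.aemeasurable_snd
  unfold density
  fun_prop

end integrability

/-! ### The energy identity and the case of equality -/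

section identity

variable {k₁ k₃ : ℝ} (hk₁ : 0 < k₁) (hk₃ : 0 < k₃) {ψ : ℝ × ℝ → ℝ} {f : ℝ → ℝ}

include hk₁ hk₃

/-- On almost every ray the integrand is the derivative of `r R(ψ - θ, θ)`. Since `R` is integrable
there, `r R` leaves nothing at `r = 0`, and only the value at `r = 1` remains. -/
lemma integral_radialTerm (hX : MemX 1 ψ) (hf : HasTrace ψ f) :
    ∫ z in D, radialTerm k₁ k₃ z.1 z.2 (ψ z) (weakDeriv eR ψ z)
      = ∫ θ in Ioo 0 Real.pi, radialPotential k₁ k₃ (f θ - θ) θ := by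
  have hE := hX.finiteEnergy
  have i1 := hE.integrableOn_radialTerm hk₁ hk₃
  have i2 := hE.integrableOn_radialPotential hk₁ hk₃
  rw [D, setIntegral_rect i1]
  rw [D, IntegrableOn, restrict_prod] at i1 i2
  refine integral_congr_ae ?_
  filter_upwards [i1.prod_left_ae, i2.prod_left_ae, hf.ae_eq_add_integral] with θ h1 h2 h3
  have hrep := (h3 (1 / 2) (by norm_num)).2
  have hint := fun r hr => (h3 r hr).1
  -- The absolutely continuous representative of `ψ - θ` on the ray, with the trace as its value at
  -- `r = 1`.
  set w : ℝ → ℝ := fun r => f θ - (∫ t in r..1, weakDeriv eR ψ (t, θ)) - θ with hw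
  rw [← integral_Ioc_eq_integral_Ioo, ← intervalIntegral.integral_of_le zero_le_one]
  have hw1 : w 1 = f θ - θ := by simp [hw]
  have := integral_eq_of_primitive_left (a := 0) (b := 1)
    (H := fun r => r * radialPotential k₁ k₃ (w r) θ)
    (h := fun r => radialTerm k₁ k₃ r θ (ψ (r, θ)) (weakDeriv eR ψ (r, θ))) zero_lt_one ?_ h1 ?_
  · simpa [hw1] using this
  · intro x hx
    have key := integral_fderiv_comp_eq_sub (contDiff_mul_radialPotential hk₁ hk₃ θ)
      (u := w) hx.2.le (hint x hx) (by
        intro y hy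
        have hy0 : IntervalIntegrable (fun t => weakDeriv eR ψ (t, θ)) volume x y :=
          (hint x hx).mono_set (uIcc_subset_uIcc left_mem_uIcc
            (by rw [uIcc_of_le hx.2.le]; exact hy))
        have hy1 : IntervalIntegrable (fun t => weakDeriv eR ψ (t, θ)) volume y 1 :=
          (hint x hx).mono_set (uIcc_subset_uIcc
            (by rw [uIcc_of_le hx.2.le]; exact hy) right_mem_uIcc)
        have := intervalIntegral.integral_add_adjacent_intervals hy0 hy1
        simp only [hw]
        linarith)
    rw [← key]
    refine intervalIntegral.integral_congr_ae ?_
    filter_upwards [(ae_restrict_iff' measurableSet_Ioo).1 hrep,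
      (by simp [ae_iff] : ∀ᵐ r : ℝ, r ≠ 1)] with r hr hr1 hrm
    rw [uIoc_of_le hx.2.le] at hrm
    have e := hr ⟨hx.1.trans hrm.1, lt_of_le_of_ne hrm.2 hr1⟩
    have e2 : w r = ψ (r, θ) - θ := by rw [e]
    rw [fderiv_mul_radialPotential hk₁ hk₃, e2, radialTerm, sub_add_cancel]
  · refine Integrable.congr h2 ?_
    filter_upwards [hrep, ae_restrict_mem measurableSet_Ioo] with r hr hrm
    have e2 : w r = ψ (r, θ) - θ := by rw [hr]
    rw [e2, sub_zero, mul_div_assoc, mul_div_cancel₀ _ hrm.1.ne']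

/-- On almost every half circle the integrand is the derivative of the angular potential plus `sin θ
√k₁`. The potential contributes nothing at the two ends, so the result does not depend on `ψ`. -/
lemma integral_angularTerm (hX : MemX 1 ψ) :
    ∫ z in D, angularTerm k₁ k₃ z.2 (ψ z) (weakDeriv eTheta ψ z)
      = ∫ _ in Ioo (0 : ℝ) 1, ∫ θ in (0 : ℝ)..Real.pi, Real.sin θ * √k₁ := by
  have hpi := Real.pi_pos
  have hE := hX.finiteEnergy
  obtain ⟨⟨-, -, ⟨g, hg, -⟩⟩, -⟩ := hX
  have hrepq := (isWeakDeriv_weakDeriv ⟨g, hg⟩).ae_exists_eq_const_add_integral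
  set q := weakDeriv eTheta ψ
  have i1 := hE.integrableOn_angularTerm hk₁ hk₃
  have i2 := hE.integrableOn_angularPotential (k₁ := k₁) (k₃ := k₃)
  rw [D, IntegrableOn, restrict_prod] at i1 i2
  rw [D, restrict_prod, integral_prod _ i1]
  refine integral_congr_ae ?_
  filter_upwards [i1.prod_right_ae, i2.prod_right_ae, hrepq] with r h1 h2 h3
  obtain ⟨hint, C, hrep⟩ := h3
  set w : ℝ → ℝ := fun θ => C + (∫ t in (Real.pi / 2)..θ, q (r, t)) - θ with hw
  have hwψ : ∀ᵐ θ ∂volume.restrict (Ioo 0 Real.pi), w θ = ψ (r, θ) - θ := by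
    filter_upwards [hrep] with θ h
    rw [h]
  have hs : Continuous fun θ : ℝ => Real.sin θ * √k₁ := by fun_prop
  -- To be used with `F = θ` and `F = π - θ`: both dominate `sin θ`, so integrability of the
  -- potential divided by `sin θ` carries over.
  have hbound : ∀ F : ℝ → ℝ, Measurable F → (∀ θ ∈ Ioo 0 Real.pi, Real.sin θ ≤ F θ) →
      IntegrableOn (fun θ => angularPotential k₁ k₃ (w θ) θ / F θ) (Ioo 0 Real.pi) := by
    intro F hF hFle
    have h2' : IntegrableOn (fun θ => angularPotential k₁ k₃ (w θ) θ / Real.sin θ)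
        (Ioo 0 Real.pi) := by
      refine Integrable.congr h2 ?_
      filter_upwards [hwψ] with θ h
      rw [h]
    have e : (fun θ => angularPotential k₁ k₃ (w θ) θ / Real.sin θ * (Real.sin θ / F θ))
        =ᵐ[volume.restrict (Ioo 0 Real.pi)] fun θ => angularPotential k₁ k₃ (w θ) θ / F θ := by
      filter_upwards [ae_restrict_mem measurableSet_Ioo] with θ hθ
      have hσ := Real.sin_pos_of_mem_Ioo hθ
      have hF0 := hσ.trans_le (hFle θ hθ)
      field_simp
    refine Integrable.congr ?_ e
    refine Integrable.mul_bdd (c := 1) h2'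
      (Real.measurable_sin.div hF).aestronglyMeasurable ?_
    filter_upwards [ae_restrict_mem measurableSet_Ioo] with θ hθ
    have hσ := Real.sin_pos_of_mem_Ioo hθ
    have hF0 := hσ.trans_le (hFle θ hθ)
    rw [Real.norm_of_nonneg (by positivity), div_le_one hF0]
    exact hFle θ hθ
  have hzero := integral_eq_zero_of_primitive (a := 0) (b := Real.pi)
    (H := fun θ => angularPotential k₁ k₃ (w θ) θ)
    (h := fun θ => angularTerm k₁ k₃ θ (ψ (r, θ)) (q (r, θ)) - Real.sin θ * √k₁) hpi ?_
    (Integrable.sub h1 (hs.integrableOn_Icc.mono_set Ioo_subset_Icc_self))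
    (hbound _ (by fun_prop) fun θ hθ => by rw [sub_zero]; exact Real.sin_le hθ.1.le)
    (hbound _ (by fun_prop) fun θ hθ => by
      rw [← Real.sin_pi_sub]; exact Real.sin_le (by linarith [hθ.2]))
  · have hi : IntervalIntegrable (fun θ => angularTerm k₁ k₃ θ (ψ (r, θ)) (q (r, θ)))
        volume 0 Real.pi := by
      rw [intervalIntegrable_iff_integrableOn_Ioo_of_le hpi.le]; exact h1
    rw [intervalIntegral.integral_sub hi (hs.intervalIntegrable _ _), sub_eq_zero] at hzero
    rw [← hzero, intervalIntegral.integral_of_le hpi.le, integral_Ioc_eq_integral_Ioo]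
  · intro x hx y hy hxy
    have hsub : Icc x y ⊆ Ioo 0 Real.pi := fun s hs => ⟨hx.1.trans_le hs.1, hs.2.trans_lt hy.2⟩
    have hmid : Real.pi / 2 ∈ Ioo 0 Real.pi := ⟨by linarith, by linarith⟩
    have key := integral_fderiv_comp_eq_sub (contDiff_angularPotential (k₁ := k₁) (k₃ := k₃))
      (u := w) (q := fun t => q (r, t) - 1) hxy
      ((hint x hx y hy).sub intervalIntegrable_const) (by
        intro s hs
        have hsm := hsub hs
        rw [intervalIntegral.integral_sub (hint x hx s hsm) intervalIntegrable_const,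
          intervalIntegral.integral_const, smul_eq_mul, mul_one]
        have := intervalIntegral.integral_add_adjacent_intervals (hint _ hmid x hx)
          (hint x hx s hsm)
        simp only [hw]
        linarith)
    rw [← key]
    refine intervalIntegral.integral_congr_ae ?_
    filter_upwards [(ae_restrict_iff' measurableSet_Ioo).1 hwψ] with θ hθ hθm
    rw [uIoc_of_le hxy] at hθm
    rw [fderiv_angularPotential, hθ (hsub (Ioc_subset_Icc_self hθm)), angularTerm, sub_add_cancel]

/-- The excess of the energy density over the calibrating null Lagrangian. -/
noncomputable def excess (k₁ k₃ : ℝ) (ψ : ℝ × ℝ → ℝ) (z : ℝ × ℝ) : ℝ :=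
  Real.sin z.2 * quadForm k₁ k₃ (ψ z - z.2) (z.1 * weakDeriv eR ψ z)
    (weakDeriv eTheta ψ z - slope k₁ k₃ z.2 (ψ z))

lemma excess_nonneg {z : ℝ × ℝ} (hz : z ∈ D) : 0 ≤ excess k₁ k₃ ψ z :=
  mul_nonneg (Real.sin_pos_of_mem_Ioo hz.2).le (quadForm_nonneg hk₁ hk₃ _ _ _)

lemma density_eq_add_excess {z : ℝ × ℝ} (hz : z ∈ D) :
    density k₁ k₃ z.1 z.2 (ψ z) (weakDeriv eR ψ z) (weakDeriv eTheta ψ z)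
        * (z.1 ^ 2 * Real.sin z.2)
      = 2 * √k₁ * (radialTerm k₁ k₃ z.1 z.2 (ψ z) (weakDeriv eR ψ z)
          + angularTerm k₁ k₃ z.2 (ψ z) (weakDeriv eTheta ψ z)) + excess k₁ k₃ ψ z :=
  density_mul_eq hk₁ hk₃ hz.1.1 (Real.sin_pos_of_mem_Ioo hz.2) _ _ _

lemma integrableOn_excess (hX : MemX 1 ψ) : IntegrableOn (excess k₁ k₃ ψ) D := by
  have hE := hX.finiteEnergy
  refine IntegrableOn.congr_fun ((hE.integrableOn_density hk₁ hk₃).sub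
    (((hE.integrableOn_radialTerm hk₁ hk₃).add
      (hE.integrableOn_angularTerm hk₁ hk₃)).const_mul (2 * √k₁))) (fun z hz => ?_) measurableSet_D
  simp only [Pi.sub_apply, Pi.add_apply]
  rw [density_eq_add_excess hk₁ hk₃ hz]
  ring

/-- Apart from the excess, the right-hand side involves `ψ` only through its trace. -/
lemma integral_density_eq (hX : MemX 1 ψ) (hf : HasTrace ψ f) :
    ∫ z in D, density k₁ k₃ z.1 z.2 (ψ z) (weakDeriv eR ψ z) (weakDeriv eTheta ψ z)
        * (z.1 ^ 2 * Real.sin z.2)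
      = 2 * √k₁ * ((∫ θ in Ioo 0 Real.pi, radialPotential k₁ k₃ (f θ - θ) θ)
          + ∫ _ in Ioo (0 : ℝ) 1, ∫ θ in (0 : ℝ)..Real.pi, Real.sin θ * √k₁)
        + ∫ z in D, excess k₁ k₃ ψ z := by
  have hE := hX.finiteEnergy
  have iR := hE.integrableOn_radialTerm hk₁ hk₃
  have iA := hE.integrableOn_angularTerm hk₁ hk₃
  have iRA : IntegrableOn (fun z => 2 * √k₁ * (radialTerm k₁ k₃ z.1 z.2 (ψ z) (weakDeriv eR ψ z)
      + angularTerm k₁ k₃ z.2 (ψ z) (weakDeriv eTheta ψ z))) D := (iR.add iA).const_mul _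
  rw [setIntegral_congr_fun measurableSet_D fun z hz => density_eq_add_excess hk₁ hk₃ hz,
    integral_add iRA (integrableOn_excess hk₁ hk₃ hX), integral_const_mul,
    integral_add iR iA, integral_radialTerm hk₁ hk₃ hX hf, integral_angularTerm hk₁ hk₃ hX]

/-- Two functions of class `X₁` with the same trace: their energies differ by the integrals of
their excesses. -/
theorem J_sub_J {ψ' : ℝ × ℝ → ℝ} (hX : MemX 1 ψ) (hX' : MemX 1 ψ') (hf : HasTrace ψ f)
    (hf' : HasTrace ψ' f) :
    J k₁ k₃ ψ - J k₁ k₃ ψ'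
      = Real.pi * ((∫ z in D, excess k₁ k₃ ψ z) - ∫ z in D, excess k₁ k₃ ψ' z) := by
  -- Each `trace` is a choice, but both agree almost everywhere with `f`.
  have hb : ∫ θ in (0 : ℝ)..Real.pi,
        ((trace ψ θ - Real.sin (trace ψ θ) * Real.cos (trace ψ θ)) * Real.cos θ
          - Real.sin (trace ψ θ) ^ 2 * Real.sin θ)
      = ∫ θ in (0 : ℝ)..Real.pi,
        ((trace ψ' θ - Real.sin (trace ψ' θ) * Real.cos (trace ψ' θ)) * Real.cos θ
          - Real.sin (trace ψ' θ) ^ 2 * Real.sin θ) := by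
    rw [intervalIntegral.integral_of_le Real.pi_pos.le,
      intervalIntegral.integral_of_le Real.pi_pos.le, integral_Ioc_eq_integral_Ioo,
      integral_Ioc_eq_integral_Ioo]
    refine integral_congr_ae ?_
    filter_upwards [(trace_ae_eq hf).trans (trace_ae_eq hf').symm] with θ hθ
    rw [hθ]
  unfold J
  rw [hb, integral_density_eq hk₁ hk₃ hX hf, integral_density_eq hk₁ hk₃ hX' hf']
  ring

lemma excess_ae_eq_zero_of_ae_eq_lift {t : ℝ} (hf : IsPsi k₁ k₃ t f) (hX : MemX 1 ψ)
    (h : ψ =ᵐ[volume.restrict D] lift f) : excess k₁ k₃ ψ =ᵐ[volume.restrict D] 0 := by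
  obtain ⟨⟨-, ⟨g₁, hg₁, -⟩, ⟨g₂, hg₂, -⟩⟩, -⟩ := hX
  have hR := (isWeakDeriv_weakDeriv ⟨g₁, hg₁⟩).ae_eq (isWeakDeriv_eR_lift hf.continuousOn) h
  have hT := (isWeakDeriv_weakDeriv ⟨g₂, hg₂⟩).ae_eq (isWeakDeriv_eTheta_lift
    (fun θ hθ => hf.hasDerivAt hθ) (hf.continuousOn_slope hk₁ hk₃)) h
  filter_upwards [h, hR, hT] with z h1 h2 h3
  rw [excess, h1, h2, h3]
  simp [lift, quadForm]

/-- Zero excess gives `∂_r ψ = 0`, so on almost every ray `ψ` is constant and equal to its boundary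
value; the angular equation is not used. -/
lemma ae_eq_lift_of_excess_ae_eq_zero (hX : MemX 1 ψ) (hf : HasTrace ψ f)
    (hfc : ContinuousOn f (Ioo 0 Real.pi)) (h : excess k₁ k₃ ψ =ᵐ[volume.restrict D] 0) :
    ψ =ᵐ[volume.restrict D] lift f := by
  have hp : ∀ᵐ z ∂volume.restrict D, weakDeriv eR ψ z = 0 := by
    filter_upwards [h, ae_restrict_mem measurableSet_D] with z hz hzD
    have hσ := Real.sin_pos_of_mem_Ioo hzD.2
    have hq := (mul_eq_zero.1 hz).resolve_left hσ.ne'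
    exact (mul_eq_zero.1 (eq_zero_of_quadForm_eq_zero hk₁ hk₃ hq)).resolve_left hzD.1.1.ne'
  have hm : AEMeasurable (fun z => ψ z - lift f z) (volume.restrict D) :=
    hX.finiteEnergy.aemeasurable.sub
      ((continuousOn_lift hfc _).aestronglyMeasurable measurableSet_D).aemeasurable
  -- Passing from almost every ray back to almost every point of `D` requires a measurable set,
  -- hence a measurable representative.
  obtain ⟨G, hG, hGe⟩ := hm
  have hG0 : ∀ᵐ θ ∂volume.restrict (Ioo 0 Real.pi), ∀ᵐ r ∂volume.restrict (Ioo (0 : ℝ) 1),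
      G (r, θ) = 0 := by
    filter_upwards [ae_snd_of_ae hp, ae_snd_of_ae hGe, hf.ae_eq_add_integral] with θ h1 h2 h3
    filter_upwards [h2, (h3 (1 / 2) (by norm_num)).2, ae_restrict_mem measurableSet_Ioo]
      with r h4 h5 hr
    have e : ∫ s in r..1, weakDeriv eR ψ (s, θ) = 0 := by
      refine intervalIntegral.integral_zero_ae ?_
      filter_upwards [(ae_restrict_iff' measurableSet_Ioo).1 h1,
        (by simp [ae_iff] : ∀ᵐ s : ℝ, s ≠ 1)] with s hs hs1 hsm
      rw [uIoc_of_le hr.2.le] at hsm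
      exact hs ⟨hr.1.trans hsm.1, lt_of_le_of_ne hsm.2 hs1⟩
    rw [← h4, h5, e]
    simp [lift]
  have hGz : ∀ᵐ z ∂volume.restrict D, G z = 0 := by
    have hset : MeasurableSet {z | G z = 0} := hG (measurableSet_singleton 0)
    rw [D, restrict_prod, ← Measure.prod_swap, ae_map_iff measurable_swap.aemeasurable hset]
    exact (Measure.ae_prod_iff_ae_ae (measurable_swap hset)).2 hG0
  filter_upwards [hGe, hGz] with z h1 h2
  rw [h2] at h1
  linarith

end identity

end OseenFrank

theorem mainTheorem2 (k₁ k₃ : ℝ) (hk₁ : 0 < k₁) (hk₃ : 0 < k₃)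
    (t : ℝ) (ht : t ∈ Set.Ioo 0 Real.pi) :
    (∃ ψt : ℝ → ℝ, OseenFrank.IsPsi k₁ k₃ t ψt) ∧
    ∀ ψt : ℝ → ℝ, OseenFrank.IsPsi k₁ k₃ t ψt →
      (∀ f : ℝ → ℝ, OseenFrank.IsPsi k₁ k₃ t f → Set.EqOn f ψt (Set.Ioo 0 Real.pi)) ∧
      OseenFrank.MemX 1 (OseenFrank.lift ψt) ∧
      OseenFrank.HasTrace (OseenFrank.lift ψt) ψt ∧
      ∀ ψ : ℝ × ℝ → ℝ, OseenFrank.MemX 1 ψ → OseenFrank.HasTrace ψ ψt →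
        OseenFrank.J k₁ k₃ (OseenFrank.lift ψt) ≤ OseenFrank.J k₁ k₃ ψ ∧
        (OseenFrank.J k₁ k₃ ψ = OseenFrank.J k₁ k₃ (OseenFrank.lift ψt) ↔
          ψ =ᵐ[MeasureTheory.volume.restrict OseenFrank.D] OseenFrank.lift ψt) := by
  open OseenFrank in
  refine ⟨exists_isPsi hk₁ hk₃ t, fun ψt hψt => ?_⟩
  have hX := hψt.memX hk₁ hk₃ ht
  have hT := hasTrace_lift hψt.continuousOn
  refine ⟨fun f hf => hf.eqOn hk₁ hk₃ hψt, hX, hT, fun ψ hψX hψT => ?_⟩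
  have hJ := J_sub_J hk₁ hk₃ hψX hX hψT hT
  -- The solution has no excess, so the energy difference is `π` times the integral of the excess of
  -- `ψ`.
  rw [integral_eq_zero_of_ae (excess_ae_eq_zero_of_ae_eq_lift hk₁ hk₃ hψt hX (.refl _ _)),
    sub_zero] at hJ
  have hnn : 0 ≤ᵐ[volume.restrict D] excess k₁ k₃ ψ := by
    filter_upwards [ae_restrict_mem measurableSet_D] with z hz
    exact excess_nonneg hk₁ hk₃ hz
  have hpos := integral_nonneg_of_ae hnn
  have hiff := integral_eq_zero_iff_of_nonneg_ae hnn (integrableOn_excess hk₁ hk₃ hψX)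
  refine ⟨by linarith [mul_nonneg Real.pi_pos.le hpos], fun h => ?_, fun h => ?_⟩
  · rw [h, sub_self, zero_eq_mul, or_iff_right Real.pi_ne_zero] at hJ
    exact ae_eq_lift_of_excess_ae_eq_zero hk₁ hk₃ hψX hψT hψt.continuousOn (hiff.1 hJ)
  · rw [integral_eq_zero_of_ae (excess_ae_eq_zero_of_ae_eq_lift hk₁ hk₃ hψt hψX h), mul_zero] at hJ
    linarith
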